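/- **Setting.** Let $N\ge 1$, $\lambda>0$, let $\kappa$ be a finite set, $p:\kappa\to\mathbb R$, let $\mathcal P$ be the algebra of diagonal $\kappa\times\kappa$ matrices, $\mathfrak p=\mathrm{diag}(p)\in\mathcal P$, and $\mathcal M=M_2(\mathbb C)$. All operators act on $\mathbb C^\kappa\otimes\mathbb C^2\otimes(\mathbb C^2)^{\otimes N}$; a subscript $l$ on a $2\times2$ matrix means that it acts on the $l$-th field factor. Put $\sigma_-=\begin{pmatrix}0&0\\1&0\end{pmatrix}$, $\sigma_+=\sigma_-^*$, $\Phi=(0,1)^{\mathsf T}$, $\Delta A(l)=\lambda(\sigma_-)_l$, $\Delta\Lambda(l)=(\sigma_+\sigma_-)_l$, $\Delta t(l)=\lambda^2 I$, $\Delta W(l)=\Delta A(l)+\Delta A(l)^*$. Let $M^{\pm},M^+,M^-,M^\circ:\mathbb C\to\mathcal M$ be such that $M_l=I+M^\pm(\mathfrak p)\Delta\Lambda(l)+M^+(\mathfrak p)\Delta A(l)^*+M^-(\mathfrak p)\Delta A(l)+M^\circ(\mathfrak p)\Delta t(l)$ is unitary for $1\le l\le N$, where $K(\mathfrak p)$ is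 the block diagonal operator with blocks $K(p_a)$, $a\in\kappa$. Put $U(0)=I$, $U(l)=M_lU(l-1)$, $j_l(X)=U(l)^*XU(l)$, $\Delta Y(l)=j_l(\Delta W(l))$, and let $\mathcal C_l$, resp. $\mathcal Y_l$, be the (commutative) $*$-algebra generated by $\Delta W(i)$, resp. $\Delta Y(i)$, $1\le i\le l$. A density matrix $\rho$ on $\mathbb C^\kappa\otimes\mathbb C^2$ defines the state $\mathbb P(X)=\mathrm{Tr}[X(\rho\otimes(\Phi\Phi^*)^{\otimes N})]$. For a commutative $*$-algebra $\mathcal C$ and $A$ in its commutant, $\mathbb P(A|\mathcal C)$ is any $E\in\mathcal C$ with $\mathbb P(EK)=\mathbb P(AK)$ for all $K\in\mathcal C$. Write $|A|^2=A^*A$. Fix $X_{\rm e}\in\mathcal M$, $\mu_1\in\mathbb R$, $\mu_2>0$, density matrices $\rho^{\rm true}=\rho^{\rm true}_{\rm p}\otimes\rho^{\rm true}_{\rm s}$ and $\rho^{\rm nom}=\rho^{\rm nom}_{\rm p}\otimes\rho^{\rm nom}_{\rm s}$ in $\mathcal P\otimes\mathcal M$ with corresponding states $\mathbb P_{\rm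 true},\mathbb P_{\rm nom}$, and $\mathfrak u_i\in\mathcal Y_i$ $(i=1,\dots,N)$. Let $V(0)=V^\mu(0)=I$, $V(l)-V(l-1)=[M^+(\mathfrak p)\Delta W(l)+M^\circ(\mathfrak p)\Delta t(l)]V(l-1)$ and $$V^\mu(l)-V^\mu(l-1)=\big[\{M^\circ(\mathfrak p)E_{l-1}+\lambda^{-2}(E_{l-1}-I)\}\Delta t(l)+M^+(\mathfrak p)E_{l-1}\Delta W(l)\big]V^\mu(l-1),$$ where $E_0=I$ and $E_i=\exp\!\big(\tfrac{\mu_1}{2}\lambda^2|X_{\rm e}-U(i)\mathfrak u_iU(i)^*|^2\big)$ for $i\ge1$. Let $1\le l\le N$ and let $\iota$ be a $*$-isomorphism of $\mathcal Y_l$ onto the bounded measurable functions on a measurable space $\Omega$. The unnormalized true filter $\varrho_l^{\rm true}$ and nominal risk-sensitive filter $\varrho_l^{\mu,\rm nom}$ are the functions $\Omega\to\mathcal P\otimes\mathcal M$ determined by $$\mathrm{Tr}[\varrho_l^{\rm true}X]=\iota\big(U(l)^*\,\mathbb P_{\rm true}(V(l)^*XV(l)|\mathcal C_l)\,U(l)\big),\qquad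 \mathrm{Tr}[\varrho_l^{\mu,\rm nom}X]=\iota\big(U(l)^*\,\mathbb P_{\rm nom}(V^\mu(l)^*XV^\mu(l)|\mathcal C_l)\,U(l)\big)$$ for all $X\in\mathcal P\otimes\mathcal M$. Where the traces do not vanish put $\rho_l^{\rm true}=\varrho_l^{\rm true}/\mathrm{Tr}\,\varrho_l^{\rm true}$, $\rho_l^{\mu,\rm nom}=\varrho_l^{\mu,\rm nom}/\mathrm{Tr}\,\varrho_l^{\mu,\rm nom}$, and put $u_l=\iota(\mathfrak u_l)$. Let $R(\rho\|\rho')=\mathrm{Tr}[\rho(\log\rho-\log\rho')]$ if $\mathrm{supp}\,\rho\subseteq\mathrm{supp}\,\rho'$ and $R(\rho\|\rho')=+\infty$ otherwise. Finally let $R(0)=R(1)=I$, $R(i)=\exp\!\big(\tfrac{\mu_1}{2}\lambda^2|j_{i-1}(X_{\rm e})-\mathfrak u_{i-1}|^2\big)R(i-1)$ for $i\ge 2$, and $$F(\mathfrak u_1,\dots,\mathfrak u_i)=\mathbb P_{\rm nom}\big[R(i)^*e^{\mu_2|j_i(X_{\rm e})-\mathfrak u_i|^2}R(i)\big].$$ The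 sequence $(\mathfrak u_i)$ is called a (nominal) suboptimal risk-sensitive estimator if, for every $1\le i\le N$, $\mathfrak u_i$ minimizes $F(\mathfrak u_1,\dots,\mathfrak u_{i-1},\,\cdot\,)$ over $\mathcal Y_i$. **Theorem.** The conditional expectation $\mathbb P_{\rm true}[|j_l(X_{\rm e})-\mathfrak u_l|^2\,|\,\mathcal Y_l]$ exists, the functions $\varrho_l^{\rm true}$ and $\varrho_l^{\mu,\rm nom}$ exist and are unique, and a suboptimal risk-sensitive estimator exists. Moreover: (a) $\mathrm{Tr}\,\varrho_l^{\rm true}\ne0$ almost surely with respect to every probability measure $\mathbf Q$ on $\Omega$ that represents $\mathbb P_{\rm true}$ on $\mathcal Y_l$, i.e. with $\mathbb P_{\rm true}(A)=\mathbf E_{\mathbf Q}[\iota(A)]$ for $A\in\mathcal Y_l$. (b) For every version of the conditional expectation and at every point of $\Omega$ at which $\mathrm{Tr}\,\varrho_l^{\rm true}\neq0$ and $\mathrm{Tr}\,\varrho_l^{\mu,\rm nom}\ne0$, the left-hand side below is real and $$\iota\Big(\mathbb P_{\rm true}\big[|j_l(X_{\rm e})-\mathfrak u_l|^2\,\big|\,\mathcal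 Y_l\big]\Big)\le\frac1{\mu_2}\log\mathrm{Tr}\big[\rho_l^{\mu,\rm nom}e^{\mu_2|X_{\rm e}-u_l|^2}\big]+\frac1{\mu_2}R\big(\rho_l^{\rm true}\,\big\|\,\rho_l^{\mu,\rm nom}\big).$$ (c) If $(\mathfrak u_i)$ is a suboptimal risk-sensitive estimator, then at every point of $\Omega$ at which $\mathrm{Tr}\,\varrho_l^{\mu,\rm nom}\ne0$ the first term is minimal: for all $z\in\mathbb C$, $$\frac1{\mu_2}\log\mathrm{Tr}\big[\rho_l^{\mu,\rm nom}e^{\mu_2|X_{\rm e}-u_l|^2}\big]\le\frac1{\mu_2}\log\mathrm{Tr}\big[\rho_l^{\mu,\rm nom}e^{\mu_2|X_{\rm e}-z|^2}\big].$$ -/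

import Mathlib

open scoped Kronecker

noncomputable section

namespace RiskSensitive

/-! ## Finite-dimensional quantum probability -/

/-- `|A|² = A* A`. -/
def absSq {n : Type*} [Fintype n] (A : Matrix n n ℂ) : Matrix n n ℂ := star A * A

open scoped ComplexOrder in
/-- Density matrices: positive semidefinite of trace one. -/
def IsDensity {n : Type*} [Fintype n] (ρ : Matrix n n ℂ) : Prop :=
  ρ.PosSemidef ∧ ρ.trace = 1

/-- The support of a positive semidefinite matrix (the span of its eigenvectors with nonzero
eigenvalue) is its range. -/
def supp {n : Type*} [Fintype n] (ρ : Matrix n n ℂ) : Submodule ℂ (n → ℂ) :=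
  LinearMap.range ρ.mulVecLin

open Classical in
/-- The quantum relative entropy `R(ρ‖ρ')`, with values in the extended reals. The logarithms are
those of the functional calculus with the value `0` on the kernel, which does not contribute to the
trace when `supp ρ ⊆ supp ρ'`. -/
def relEntropy {n : Type*} [Fintype n] [DecidableEq n] (ρ ρ' : Matrix n n ℂ) : EReal :=
  if supp ρ ≤ supp ρ' then
    (((ρ * (cfc Real.log ρ - cfc Real.log ρ')).trace.re : ℝ) : EReal)
  else ⊤

/-- `E` is a version of the quantum conditional expectation of `A`, an element of the commutant
of `C`, onto the `*`-algebra `C` under the state `P`. -/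
def IsCondExp {n : Type*} [Fintype n] [DecidableEq n] (P : Matrix n n ℂ → ℂ)
    (C : StarSubalgebra ℂ (Matrix n n ℂ)) (A : Matrix n n ℂ) (E : C) : Prop :=
  (∀ K : C, A * (K : Matrix n n ℂ) = (K : Matrix n n ℂ) * A) ∧
  ∀ K : C, P ((E : Matrix n n ℂ) * (K : Matrix n n ℂ)) = P (A * (K : Matrix n n ℂ))

/-- A `*`-isomorphism of the `*`-algebra `C` onto the algebra of all bounded measurable complex
functions on a measurable space `Ω`. -/
structure SpectralIso {n : Type*} [Fintype n] [DecidableEq n]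
    (C : StarSubalgebra ℂ (Matrix n n ℂ)) (Ω : Type*) [MeasurableSpace Ω] where
  toHom : C →⋆ₐ[ℂ] (Ω → ℂ)
  injective : Function.Injective toHom
  range_eq : Set.range toHom = {f : Ω → ℂ | Measurable f ∧ ∃ c : ℝ, ∀ ω, ‖f ω‖ ≤ c}

/-- The classical measure `Q` represents the state `P` on `C` through `ι`. -/
def SpectralIso.Represents {n : Type*} [Fintype n] [DecidableEq n]
    {C : StarSubalgebra ℂ (Matrix n n ℂ)} {Ω : Type*} [MeasurableSpace Ω]
    (ι : SpectralIso C Ω) (P : Matrix n n ℂ → ℂ) (Q : MeasureTheory.Measure Ω) : Prop :=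
  ∀ A : C, P (A : Matrix n n ℂ) = ∫ ω, ι.toHom A ω ∂Q

/-! ## The atom, the parameter and the discrete field

The parameter space is a finite set `κ`; the operators of the total system act on
`ℂ^κ ⊗ ℂ² ⊗ (ℂ²)^{⊗N}`. -/

/-- Operators on parameter space and atom, `ℂ^κ ⊗ ℂ²`. -/
abbrev SysOp (κ : Type*) := Matrix (κ × Fin 2) (κ × Fin 2) ℂ

/-- Operators on the field, `(ℂ²)^{⊗N}`. -/
abbrev FieldOp (N : ℕ) := Matrix (Fin N → Fin 2) (Fin N → Fin 2) ℂ

/-- Operators on the total space `ℂ^κ ⊗ ℂ² ⊗ (ℂ²)^{⊗N}`. -/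
abbrev TotOp (κ : Type*) (N : ℕ) :=
  Matrix ((κ × Fin 2) × (Fin N → Fin 2)) ((κ × Fin 2) × (Fin N → Fin 2)) ℂ

/-- The algebra `𝒫 ⊗ ℳ`, where `𝒫` are the diagonal `κ × κ` matrices and `ℳ` the `2 × 2`
matrices. -/
def paramSysAlg (κ : Type*) : Set (SysOp κ) :=
  {X | ∀ a b i j, a ≠ b → X (a, i) (b, j) = 0}

/-- `I^{⊗(l-1)} ⊗ X ⊗ I^{⊗(N-l)}`, for `1 ≤ l ≤ N`. -/
def slice (N l : ℕ) (X : Matrix (Fin 2) (Fin 2) ℂ) : FieldOp N :=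
  Matrix.of fun s t =>
    ∏ k : Fin N, (if (k : ℕ) + 1 = l then X else (1 : Matrix (Fin 2) (Fin 2) ℂ)) (s k) (t k)

def sigmaMinus : Matrix (Fin 2) (Fin 2) ℂ := !![0, 0; 1, 0]

def sigmaPlus : Matrix (Fin 2) (Fin 2) ℂ := !![0, 1; 0, 0]

/-- The vacuum vector `Φ = (0, 1)ᵀ`. -/
def vacuum : Fin 2 → ℂ := ![0, 1]

/-- `(Φ Φ*)^{⊗N}`. -/
def vacuumProj (N : ℕ) : FieldOp N :=
  Matrix.vecMulVec (fun s => ∏ k, vacuum (s k)) (star fun s => ∏ k, vacuum (s k))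

section

variable {κ : Type*} [Fintype κ] [DecidableEq κ] {N : ℕ}

/-- The state `P(X) = Tr[X (ρ ⊗ (ΦΦ*)^{⊗N})]`. -/
def stateOf (ρ : SysOp κ) (X : TotOp κ N) : ℂ := (X * (ρ ⊗ₖ vacuumProj N)).trace

/-- The density matrix `diag(r) ⊗ ρ_s` on `ℂ^κ ⊗ ℂ²`. -/
def prodDensity (r : κ → ℝ) (ρs : Matrix (Fin 2) (Fin 2) ℂ) : SysOp κ :=
  Matrix.diagonal (fun a => (r a : ℂ)) ⊗ₖ ρs

/-- An operator of the atom, as an operator on `ℂ^κ ⊗ ℂ²`. -/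
def atomOp (X : Matrix (Fin 2) (Fin 2) ℂ) : SysOp κ := (1 : Matrix κ κ ℂ) ⊗ₖ X

/-- An operator on `ℂ^κ ⊗ ℂ²`, as an operator on the total space. -/
def embSys (X : SysOp κ) : TotOp κ N := X ⊗ₖ (1 : FieldOp N)

/-- A field operator, as an operator on the total space. -/
def embField (X : FieldOp N) : TotOp κ N := (1 : SysOp κ) ⊗ₖ X

/-- The composition `K(𝔭)` of a matrix valued function `K` with the multiplication operator
`𝔭 = diag(p)`: it acts as `K(p a)` on the `a`-th block. -/
def compose (K : ℂ → Matrix (Fin 2) (Fin 2) ℂ) (p : κ → ℝ) : SysOp κ :=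
  Matrix.of fun x y => if x.1 = y.1 then K (p x.1) x.2 y.2 else 0

/-- `K(𝔭) = ∑_{x ∈ sp 𝔭} P_𝔭(x) ⊗ K(x)`, with the spectral projections `P_𝔭(x)` of `𝔭`. -/
theorem compose_eq_sum (K : ℂ → Matrix (Fin 2) (Fin 2) ℂ) (p : κ → ℝ) :
    compose K p = ∑ x ∈ Finset.univ.image p,
      Matrix.diagonal (fun a => if p a = x then (1 : ℂ) else 0) ⊗ₖ K (x : ℂ) := by
  ext ⟨a, i⟩ ⟨b, j⟩
  rw [Matrix.sum_apply]
  by_cases h : a = b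
  · subst h
    rw [Finset.sum_eq_single (p a)]
    · simp [compose, Matrix.kroneckerMap_apply]
    · intro x _ hx
      simp [Matrix.kroneckerMap_apply, hx.symm]
    · simp
  · simp [compose, Matrix.kroneckerMap_apply, h]

end

/-- The data of the uncertain atom-field interaction: the square root `lam` of the length of a time
slice, the values of the parameter, and the coefficients `M^±, M^+, M^-, M^∘`. -/
structure Model (κ : Type*) (N : ℕ) where
  lam : ℝ
  lam_pos : 0 < lam
  p : κ → ℝ
  Mpm : ℂ → Matrix (Fin 2) (Fin 2) ℂ
  Mplus : ℂ → Matrix (Fin 2) (Fin 2) ℂ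
  Mminus : ℂ → Matrix (Fin 2) (Fin 2) ℂ
  Mcirc : ℂ → Matrix (Fin 2) (Fin 2) ℂ

namespace Model

variable {κ : Type*} [Fintype κ] [DecidableEq κ] {N : ℕ} (m : Model κ N)

/-- `ΔA(l)`. -/
def dA (l : ℕ) : TotOp κ N := embField ((m.lam : ℂ) • slice N l sigmaMinus)

/-- `ΔA(l)*`. -/
def dAstar (l : ℕ) : TotOp κ N := embField ((m.lam : ℂ) • slice N l sigmaPlus)

/-- `ΔΛ(l)`. -/
def dLambda (_m : Model κ N) (l : ℕ) : TotOp κ N := embField (slice N l (sigmaPlus * sigmaMinus))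

/-- `Δt(l)`. -/
def dt (l : ℕ) : TotOp κ N := embField (((m.lam : ℂ) ^ 2) • slice N l 1)

/-- `ΔW(l) = ΔA(l) + ΔA(l)*`. -/
def dW (l : ℕ) : TotOp κ N := m.dA l + m.dAstar l

/-- `M_l = I + M^±(𝔭) ΔΛ(l) + M^+(𝔭) ΔA(l)* + M^-(𝔭) ΔA(l) + M^∘(𝔭) Δt(l)`. -/
def step (l : ℕ) : TotOp κ N :=
  1 + embSys (compose m.Mpm m.p) * m.dLambda l + embSys (compose m.Mplus m.p) * m.dAstar l
    + embSys (compose m.Mminus m.p) * m.dA l + embSys (compose m.Mcirc m.p) * m.dt l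

/-- `M_l` is unitary for `l = 1, …, N`. -/
def IsUnitary : Prop :=
  ∀ l, 1 ≤ l → l ≤ N →
    m.step l ∈ Matrix.unitaryGroup ((κ × Fin 2) × (Fin N → Fin 2)) ℂ

/-- `U(0) = I`, `U(l) = M_l U(l-1)`. -/
def U : ℕ → TotOp κ N
  | 0 => 1
  | l + 1 => m.step (l + 1) * U l

/-- The flow `j_l(X) = U(l)* X U(l)`. -/
def flow (l : ℕ) (X : TotOp κ N) : TotOp κ N := star (m.U l) * X * m.U l

/-- `ΔY(l) = j_l(ΔW(l))`. -/
def dY (l : ℕ) : TotOp κ N := m.flow l (m.dW l)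

/-- `𝒞_l`, the `*`-algebra generated by `ΔW(1), …, ΔW(l)`. -/
def fieldAlg (l : ℕ) : StarSubalgebra ℂ (TotOp κ N) :=
  StarAlgebra.adjoin ℂ {A | ∃ i, 1 ≤ i ∧ i ≤ l ∧ A = m.dW i}

/-- The observation algebra `𝒴_l`, generated by `ΔY(1), …, ΔY(l)`. -/
def obsAlg (l : ℕ) : StarSubalgebra ℂ (TotOp κ N) :=
  StarAlgebra.adjoin ℂ {A | ∃ i, 1 ≤ i ∧ i ≤ l ∧ A = m.dY i}

/-- The (risk-neutral) process `ΔV(l) = [M^+ ΔW(l) + M^∘ Δt(l)] V(l-1)`, `V(0) = I`. -/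
def V : ℕ → TotOp κ N
  | 0 => 1
  | l + 1 => V l + (embSys (compose m.Mplus m.p) * m.dW (l + 1)
      + embSys (compose m.Mcirc m.p) * m.dt (l + 1)) * V l

/-- The estimation error `|j_l(X) - 𝔲_l|²`. -/
def errorOp (X : Matrix (Fin 2) (Fin 2) ℂ) (u : ∀ i, m.obsAlg i) (l : ℕ) : TotOp κ N :=
  absSq (m.flow l (embSys (atomOp X)) - (u l : TotOp κ N))

/-- `R(0) = R(1) = I`, `R(l) = exp[(μ₁/2) λ² |j_{l-1}(X) - 𝔲_{l-1}|²] R(l-1)`. -/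
def R (X : Matrix (Fin 2) (Fin 2) ℂ) (μ₁ : ℝ) (u : ∀ i, m.obsAlg i) : ℕ → TotOp κ N
  | 0 => 1
  | 1 => 1
  | l + 2 => NormedSpace.exp (((μ₁ / 2 * m.lam ^ 2 : ℝ) : ℂ) • m.errorOp X u (l + 1))
      * R X μ₁ u (l + 1)

/-- The risk-sensitive cost at time `l`:
`F(𝔲_1, …, 𝔲_l) = P[R(l)* exp(μ₂ |j_l(X) - 𝔲_l|²) R(l)]`, where `P` is the state given by `ρ`. -/
def cost (ρ : SysOp κ) (X : Matrix (Fin 2) (Fin 2) ℂ) (μ₁ μ₂ : ℝ) (u : ∀ i, m.obsAlg i)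
    (l : ℕ) : ℝ :=
  (stateOf ρ (star (m.R X μ₁ u l) * NormedSpace.exp ((μ₂ : ℂ) • m.errorOp X u l)
    * m.R X μ₁ u l)).re

/-- `𝔲_1, …, 𝔲_N` is a suboptimal risk-sensitive estimator of `X`: each `𝔲_l` minimizes
`F(𝔲_1, …, 𝔲_{l-1}, · )` over `𝒴_l`. -/
def IsSuboptimal (ρ : SysOp κ) (X : Matrix (Fin 2) (Fin 2) ℂ) (μ₁ μ₂ : ℝ)
    (u : ∀ i, m.obsAlg i) : Prop :=
  ∀ l, 1 ≤ l → l ≤ N → ∀ v : m.obsAlg l,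
    m.cost ρ X μ₁ μ₂ u l ≤ m.cost ρ X μ₁ μ₂ (Function.update u l v) l

/-- `𝔲̌_l = U(l) 𝔲_l U(l)* ∈ 𝒞_l`, so that `𝔲_l = j_l(𝔲̌_l)`. -/
def check (u : ∀ i, m.obsAlg i) (l : ℕ) : TotOp κ N :=
  m.U l * (u l : TotOp κ N) * star (m.U l)

/-- `exp[(μ₁/2) λ² |X - 𝔲̌_l|²]` for `l ≥ 1`. There is no estimate at time `0`, and the factor
is `I` there, in accordance with `R(1) = I`. -/
def riskFactor (X : Matrix (Fin 2) (Fin 2) ℂ) (μ₁ : ℝ) (u : ∀ i, m.obsAlg i) (l : ℕ) :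
    TotOp κ N :=
  if l = 0 then 1
  else NormedSpace.exp (((μ₁ / 2 * m.lam ^ 2 : ℝ) : ℂ) •
    absSq (embSys (atomOp X) - m.check u l))

/-- The risk-sensitive process: `V^μ(0) = I` and, with `E = exp[(μ₁/2) λ² |X - 𝔲̌_{l-1}|²]`,
`ΔV^μ(l) = [{M^∘ E + λ⁻² (E - I)} Δt(l) + M^+ E ΔW(l)] V^μ(l-1)`. -/
def Vmu (X : Matrix (Fin 2) (Fin 2) ℂ) (μ₁ : ℝ) (u : ∀ i, m.obsAlg i) : ℕ → TotOp κ N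
  | 0 => 1
  | l + 1 => Vmu X μ₁ u l +
      ((embSys (compose m.Mcirc m.p) * m.riskFactor X μ₁ u l
          + (((m.lam : ℂ) ^ 2)⁻¹) • (m.riskFactor X μ₁ u l - 1)) * m.dt (l + 1)
        + embSys (compose m.Mplus m.p) * m.riskFactor X μ₁ u l * m.dW (l + 1)) * Vmu X μ₁ u l

/-- `ϱ` is the unnormalized information density matrix at time `l` determined by the initial
density matrix `ρ` and by the operator `v` (which is `V(l)` or `V^μ(l)`): a function on `Ω` with
values in `𝒫 ⊗ ℳ` such that `ι(σ_l(X)) = Tr(ϱ X)` for all `X ∈ 𝒫 ⊗ ℳ`, where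
`σ_l(X) = U(l)* P(v* X v | 𝒞_l) U(l) ∈ 𝒴_l`. -/
def IsInfoDensity (ρ : SysOp κ) (v : TotOp κ N) (l : ℕ) {Ω : Type*} [MeasurableSpace Ω]
    (ι : SpectralIso (m.obsAlg l) Ω) (ϱ : Ω → SysOp κ) : Prop :=
  (∀ ω, ϱ ω ∈ paramSysAlg κ) ∧
  ∀ X ∈ paramSysAlg κ, ∃ (E : m.fieldAlg l) (σ : m.obsAlg l),
    IsCondExp (stateOf ρ) (m.fieldAlg l) (star v * embSys X * v) E ∧
    (σ : TotOp κ N) = star (m.U l) * (E : TotOp κ N) * m.U l ∧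
    ∀ ω, ι.toHom σ ω = (ϱ ω * X).trace

end Model

/-- The normalized density matrix `ϱ / Tr ϱ` (meaningful when `Tr ϱ ≠ 0`). -/
def normalized {n : Type*} [Fintype n] (ϱ : Matrix n n ℂ) : Matrix n n ℂ := (ϱ.trace)⁻¹ • ϱ

/-- `(1/μ₂) log Tr[ρ exp(μ₂ |X - z|²)]`. -/
def logTerm {κ : Type*} [Fintype κ] [DecidableEq κ] (ρ : SysOp κ)
    (X : Matrix (Fin 2) (Fin 2) ℂ) (μ₂ : ℝ) (z : ℂ) : ℝ :=
  1 / μ₂ * Real.log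
    ((ρ * NormedSpace.exp ((μ₂ : ℂ) • absSq (atomOp X - z • (1 : SysOp κ)))).trace.re)

end RiskSensitive

end

open RiskSensitive

/-! The bound is a duality: the error is linear in the true filter, the risk-sensitive cost is
exponential in the same error under the nominal filter, and Tr[ρG] ≤ log Tr[ρ'e^G] + R(ρ‖ρ')
compares them (`trace_mul_le_log_add_relEntropy`). It is applied at each point of Ω with G = μ₂|X_e
- u_l|² to the two normalized filters and divided by μ₂.

The inequality combines the classical Gibbs principle with the monotonicity of relative entropy
under measurement in the eigenbasis of G. Both come out of one computation. With Δ the relative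
modular operator, whose eigenvalues are q_j/p_i, the negative entropy is the mean of log Δ.
Completing a square bounds the mean of (Δ+s)⁻¹ from below, for any trial operator C
(`resolvent_le`). Integrating over s > 0 turns resolvents into logarithms (`sum_mul_log_le`).

The filters are made explicit by a change of state. The vacuum is annihilated by ΔA and ΔΛ, so that
U(l) and V(l), and likewise U(l)R(l) and V^μ(l), agree on it (`U_mul_vac`,
`IsUnitary.U_mul_R_mul_vac`). Unlike U(l), the operators V(l) and V^μ(l) commute with 𝒞_l. This
algebra consists of all functions of l signs (`mem_fieldAlg`), every sign configuration has positive
weight in the reference state, and 𝒴_l = U(l)*𝒞_l U(l). Every point of Ω picks out a configuration s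
(`IsUnitary.exists_point`), so a filter is nothing but a family of positive matrices ϱ_s
(`IsUnitary.isInfoDensity_iff`).

In these terms the conditional error e_s satisfies e_s Tr ϱ_s = Tr[ϱ_s|X_e - c_s|²]
(`IsUnitary.isCondExp_errorOp_iff`), where c_s are the values of 𝔲_l. The true probability of s is
its weight times Tr ϱ_s, which gives (a). The cost F is a weighted sum over s whose summands each
involve a single value c_s (`IsUnitary.cost_eq`). Minimizing F is therefore minimizing each summand,
which gives (c). Minimizers exist because each summand is continuous and coercive in c_s, or
constant. -/

namespace RiskSensitive

/-! ### The variational inequality for the quantum relative entropy. -/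

section Entropy

open Filter Topology
open scoped ComplexOrder

/-- Integrated form of a resolvent inequality: if the Stieltjes-type functions are ordered for all
`s > 0`, then their integrals over `s` are ordered. -/
lemma sum_mul_log_le {α β : Type*} [Fintype α] [Fintype β] (w a : α → ℝ) (P Q b : β → ℝ)
    (ha : ∀ i, 0 < a i) (hb : ∀ k, 0 < b k) (hsum : ∑ i, w i = ∑ k, P k)
    (h : ∀ s : ℝ, 0 < s →
      ∑ k, (P k / (b k + s) + (P k * b k - Q k) / (b k + s) ^ 2) ≤ ∑ i, w i / (a i + s)) :
    ∑ i, w i * Real.log (a i) ≤ ∑ k, (P k * Real.log (b k) - (P k - Q k / b k)) := by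
  -- An antiderivative in s of the difference of the two sides of `h`. It decreases to its limit 0
  -- at infinity, so f 0 ≥ 0, which is the claim; no integral has to be formed.
  set f : ℝ → ℝ := fun s => ∑ k, (P k * Real.log (s + b k) - (P k * b k - Q k) * (s + b k)⁻¹)
    - ∑ i, w i * Real.log (s + a i) with hf
  have hder : ∀ s : ℝ, 0 ≤ s → HasDerivAt f
      (∑ k, (P k / (b k + s) + (P k * b k - Q k) / (b k + s) ^ 2) - ∑ i, w i / (a i + s)) s := by
    intro s hs
    refine HasDerivAt.sub (HasDerivAt.fun_sum fun k _ => ?_) (HasDerivAt.fun_sum fun i _ => ?_)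
    · have hpos : s + b k ≠ 0 := by have := hb k; positivity
      have h1 : HasDerivAt (fun s : ℝ => s + b k) 1 s := (hasDerivAt_id s).add_const _
      have h2 := ((h1.log hpos).const_mul (P k)).sub
        ((h1.fun_inv hpos).const_mul (P k * b k - Q k))
      refine h2.congr_deriv ?_
      rw [add_comm (b k)]
      field_simp
      ring
    · have hpos : s + a i ≠ 0 := by have := ha i; positivity
      have h1 : HasDerivAt (fun s : ℝ => s + a i) 1 s := (hasDerivAt_id s).add_const _
      refine ((h1.log hpos).const_mul (w i)).congr_deriv ?_
      rw [add_comm (a i)]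
      field_simp
  have hanti : AntitoneOn f (Set.Ici 0) := by
    refine antitoneOn_of_deriv_nonpos (convex_Ici 0)
      (fun s hs => (hder s hs).continuousAt.continuousWithinAt)
      (fun s hs => ?_) (fun s hs => ?_)
    · rw [interior_Ici] at hs
      exact (hder s (le_of_lt hs)).differentiableAt.differentiableWithinAt
    · rw [interior_Ici] at hs
      rw [(hder s (le_of_lt hs)).deriv]
      linarith [h s hs]
  -- Equal total weights allow log s to be subtracted from every logarithm.
  have hlim : Tendsto f atTop (𝓝 0) := by
    have h1 : Tendsto (fun s : ℝ => ∑ k, (P k * (Real.log (s + b k) - Real.log s)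
        - (P k * b k - Q k) * (s + b k)⁻¹)
        - ∑ i, w i * (Real.log (s + a i) - Real.log s)) atTop (𝓝
          (∑ k, (P k * 0 - (P k * b k - Q k) * 0) - ∑ i, w i * 0)) := by
      refine Tendsto.sub (tendsto_finsetSum _ fun k _ => ?_) (tendsto_finsetSum _ fun i _ => ?_)
      · refine ((Real.tendsto_log_comp_add_sub_log _).const_mul _).sub (Tendsto.const_mul _ ?_)
        exact tendsto_inv_atTop_zero.comp (tendsto_atTop_add_const_right _ _ tendsto_id)
      · exact (Real.tendsto_log_comp_add_sub_log _).const_mul _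
    simp only [mul_zero, sub_zero, Finset.sum_const_zero] at h1
    refine h1.congr fun s => ?_
    simp only [hf, mul_sub, Finset.sum_sub_distrib, ← Finset.sum_mul, hsum]
    ring
  have h0 : 0 ≤ f 0 := by
    refine le_of_tendsto hlim ?_
    filter_upwards [eventually_ge_atTop (0 : ℝ)] with s hs
    exact hanti (Set.mem_Ici.2 le_rfl) hs hs
  simp only [hf, zero_add] at h0
  have : ∀ k, (P k * b k - Q k) * (b k)⁻¹ = P k - Q k / b k := fun k => by
    have := (hb k).ne'
    field_simp
  simp only [this] at h0
  linarith

variable {n : Type*} [Fintype n] [DecidableEq n]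

/-- The matrix `U diag(d) U*`. -/
noncomputable def udiag (U : Matrix n n ℂ) (d : n → ℝ) : Matrix n n ℂ :=
  U * Matrix.diagonal (fun i => (d i : ℂ)) * star U

lemma trace_udiag_mul (U : Matrix n n ℂ) (d : n → ℝ) (A : Matrix n n ℂ) :
    (udiag U d * A).trace = ∑ i, (d i : ℂ) * (star U * A * U) i i := by
  rw [udiag, mul_assoc, mul_assoc, Matrix.trace_mul_comm, mul_assoc, Matrix.trace]
  simp [Matrix.diagonal_mul, mul_assoc]

lemma udiag_mul_udiag {U : Matrix n n ℂ} (hU : star U * U = 1) (d e : n → ℝ) :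
    udiag U d * udiag U e = udiag U (fun i => d i * e i) := by
  have : udiag U d * udiag U e = U * (Matrix.diagonal (fun i => (d i : ℂ)) * (star U * U) *
    Matrix.diagonal (fun i => (e i : ℂ))) * star U := by
    simp only [udiag, mul_assoc]
  rw [this, hU, mul_one, Matrix.diagonal_mul_diagonal, udiag]
  simp

lemma star_udiag (U : Matrix n n ℂ) (d : n → ℝ) : star (udiag U d) = udiag U d := by
  simp only [udiag, star_mul, star_star, mul_assoc]
  congr 2
  rw [Matrix.star_eq_conjTranspose, Matrix.diagonal_conjTranspose]
  congr 1
  ext i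
  simp

lemma exp_udiag {U : Matrix n n ℂ} (hU : star U * U = 1) (d : n → ℝ) :
    NormedSpace.exp (udiag U d) = udiag U (fun i => Real.exp (d i)) := by
  have hinv : U⁻¹ = star U := Matrix.inv_eq_left_inv hU
  have hunit : IsUnit U := (Matrix.isUnit_iff_isUnit_det U).2
    (Matrix.isUnit_det_of_left_inverse hU)
  rw [udiag, ← hinv, Matrix.exp_conj _ _ hunit, Matrix.exp_diagonal, udiag, hinv]
  congr 3
  ext i
  rw [Pi.coe_exp, ← Complex.exp_eq_exp_ℂ]
  simp

lemma exists_eq_udiag {A : Matrix n n ℂ} (hA : A.IsHermitian) :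
    ∃ (U : Matrix n n ℂ) (d : n → ℝ), star U * U = 1 ∧ U * star U = 1 ∧ A = udiag U d ∧
      (∀ f : ℝ → ℝ, cfc f A = udiag U (fun i => f (d i))) ∧ d = hA.eigenvalues := by
  refine ⟨hA.eigenvectorUnitary, hA.eigenvalues, by simp, by simp, ?_, fun f => ?_, rfl⟩
  · conv_lhs => rw [hA.spectral_theorem]
    rfl
  · rw [hA.cfc_eq]
    rfl

lemma trace_udiag_mul_sq (U : Matrix n n ℂ) {V : Matrix n n ℂ} (hV : V * star V = 1)
    (d : n → ℝ) {C : Matrix n n ℂ} (hC : star C = C) :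
    (udiag U d * (C * C)).trace
      = ((∑ i, ∑ j, d i * Complex.normSq ((star V * C * U) j i) : ℝ) : ℂ) := by
  rw [trace_udiag_mul]
  push_cast
  refine Finset.sum_congr rfl fun i _ => ?_
  rw [← Finset.mul_sum]
  congr 1
  have : star U * (C * C) * U = star (star V * C * U) * (star V * C * U) := by
    simp only [star_mul, star_star, hC, mul_assoc]
    rw [← mul_assoc V, hV, one_mul]
  rw [this, Matrix.mul_apply]
  refine Finset.sum_congr rfl fun j _ => ?_
  rw [Matrix.star_apply, Complex.star_def, Complex.normSq_eq_conj_mul_self]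

/-- The resolvent inequality behind the monotonicity of the relative entropy. -/
lemma resolvent_le {U V C : Matrix n n ℂ} (hU : U * star U = 1)
    (hV : V * star V = 1) (p q : n → ℝ) (hp : ∀ i, 0 ≤ p i) (hq : ∀ i, 0 ≤ q i)
    (hC : star C = C) {s : ℝ} (hs : 0 < s) :
    2 * (udiag U p * C).trace.re - (udiag V q * (C * C)).trace.re
        - s * (udiag U p * (C * C)).trace.re
      ≤ ∑ i, ∑ j, Complex.normSq ((star V * U) j i) * (p i ^ 2 / (q j + s * p i)) := by
  have h1 : (udiag U p * C).trace.re
      = ∑ i, ∑ j, p i * (star ((star V * U) j i) * (star V * C * U) j i).re := by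
    rw [trace_udiag_mul, Complex.re_sum]
    refine Finset.sum_congr rfl fun i _ => ?_
    rw [Complex.re_ofReal_mul, ← Finset.mul_sum, ← Complex.re_sum]
    congr 2
    have : star U * C * U = star (star V * U) * (star V * C * U) := by
      simp only [star_mul, star_star, mul_assoc]
      rw [← mul_assoc V, hV, one_mul]
    rw [this, Matrix.mul_apply]
    rfl
  have h2 : (udiag V q * (C * C)).trace.re
      = ∑ i, ∑ j, q j * Complex.normSq ((star V * C * U) j i) := by
    rw [trace_udiag_mul_sq V hU q hC, Complex.ofReal_re, Finset.sum_comm]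
    refine Finset.sum_congr rfl fun i _ => Finset.sum_congr rfl fun j _ => ?_
    congr 1
    have : star U * C * V = star (star V * C * U) := by simp [mul_assoc, hC]
    rw [this, Matrix.star_apply, Complex.star_def, Complex.normSq_conj]
  rw [h1, h2, trace_udiag_mul_sq U hV p hC, Complex.ofReal_re, Finset.mul_sum, Finset.mul_sum,
    ← Finset.sum_sub_distrib, ← Finset.sum_sub_distrib]
  refine Finset.sum_le_sum fun i _ => ?_
  rw [Finset.mul_sum, Finset.mul_sum, ← Finset.sum_sub_distrib, ← Finset.sum_sub_distrib]
  refine Finset.sum_le_sum fun j _ => ?_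
  -- Entrywise the claim is 2p Re(b̄a) - (q + sp)|a|² ≤ p²|b|²/(q + sp), a completed square in a.
  generalize (star V * U) j i = b
  generalize (star V * C * U) j i = a
  have hd : 0 ≤ q j + s * p i := add_nonneg (hq j) (mul_nonneg hs.le (hp i))
  rcases hd.eq_or_lt with h0 | h0
  -- If the denominator vanishes then so do p and q, and both sides are 0 with the convention x/0 =
  -- 0.
  · have hp0 : p i = 0 := by
      have h3 := hq j
      have h4 := mul_nonneg hs.le (hp i)
      have : s * p i = 0 := by linarith
      exact (mul_eq_zero.1 this).resolve_left hs.ne'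
    have hq0 : q j = 0 := by rw [hp0] at h0; linarith
    simp [hp0, hq0]
  · rw [← mul_div_assoc, le_div_iff₀ h0]
    simp only [Complex.normSq_apply, Complex.star_def, Complex.mul_re, Complex.conj_re,
      Complex.conj_im]
    nlinarith [sq_nonneg ((q j + s * p i) * a.re - p i * b.re),
      sq_nonneg ((q j + s * p i) * a.im - p i * b.im)]

/-- An eigenvector of the first matrix with nonzero eigenvalue lies in the range of the second, and
vectors in that range have no component along its kernel. This removes the pairs of eigenvalues at
which the logarithm of q/p is not meaningful. -/
lemma entry_eq_zero_of_supp_le {U V : Matrix n n ℂ} {p q : n → ℝ} (hU : star U * U = 1)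
    (hV : star V * V = 1) (hsupp : supp (udiag U p) ≤ supp (udiag V q)) {i j : n}
    (hp : p i ≠ 0) (hq : q j = 0) : (star V * U) j i = 0 := by
  have h1 : (udiag U p).mulVec (U.col i) = (p i : ℂ) • U.col i := by
    have hcol : U.col i = U.mulVec (Pi.single i 1) := by simp
    rw [hcol, Matrix.mulVec_mulVec, udiag, mul_assoc, hU, mul_one, ← Matrix.mulVec_mulVec,
      Matrix.diagonal_mulVec_single, ← Matrix.mulVec_smul]
    congr 1
    ext k
    simp [Pi.single_apply]
  have h2 : U.col i ∈ supp (udiag V q) := by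
    refine hsupp ⟨((p i : ℂ)⁻¹) • U.col i, ?_⟩
    rw [Matrix.mulVecLin_apply, Matrix.mulVec_smul, h1, smul_smul, inv_mul_cancel₀, one_smul]
    exact_mod_cast hp
  obtain ⟨y, hy⟩ := h2
  have h3 : (star V * U) j i = ((star V).mulVec (U.col i)) j := by
    simp [Matrix.mul_apply, Matrix.mulVec, dotProduct]
  rw [h3, ← hy, Matrix.mulVecLin_apply, Matrix.mulVec_mulVec, udiag, ← mul_assoc, ← mul_assoc, hV,
    one_mul, ← Matrix.mulVec_mulVec, Matrix.mulVec_diagonal, hq]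
  simp

/-- The variational inequality `Tr[ρ G] ≤ log Tr[ρ' e^G] + R(ρ‖ρ')` for density matrices. -/
theorem trace_mul_le_log_add_relEntropy {ρ ρ' G : Matrix n n ℂ} (hρ : IsDensity ρ)
    (hρ' : IsDensity ρ') (hG : G.IsHermitian) :
    (((ρ * G).trace.re : ℝ) : EReal)
      ≤ ((Real.log (ρ' * NormedSpace.exp G).trace.re : ℝ) : EReal) + relEntropy ρ ρ' := by
  rw [relEntropy]
  split_ifs with hsupp
  swap
  · rw [EReal.coe_add_top]
    exact le_top
  rw [← EReal.coe_add, EReal.coe_le_coe_iff]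
  obtain ⟨U, p, hU, hU', hρU, hρf, hpe⟩ := exists_eq_udiag hρ.1.1
  obtain ⟨V, q, hV, hV', hρV, hρf', hqe⟩ := exists_eq_udiag hρ'.1.1
  obtain ⟨W, g, hW, hW', hGW, -, -⟩ := exists_eq_udiag hG
  have hp : ∀ i, 0 ≤ p i := fun i => hpe ▸ hρ.1.eigenvalues_nonneg i
  have hq : ∀ i, 0 ≤ q i := fun i => hqe ▸ hρ'.1.eigenvalues_nonneg i
  -- diagonal entries in the eigenbasis of `G`
  set P : n → ℝ := fun k => ((star W * ρ * W) k k).re with hP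
  set Q : n → ℝ := fun k => ((star W * ρ' * W) k k).re with hQ
  have hPtr : ∀ d : n → ℝ, (ρ * udiag W d).trace.re = ∑ k, P k * d k := fun d => by
    rw [Matrix.trace_mul_comm, trace_udiag_mul, Complex.re_sum]
    exact Finset.sum_congr rfl fun k _ => by rw [Complex.re_ofReal_mul, mul_comm]
  have hQtr : ∀ d : n → ℝ, (ρ' * udiag W d).trace.re = ∑ k, Q k * d k := fun d => by
    rw [Matrix.trace_mul_comm, trace_udiag_mul, Complex.re_sum]
    exact Finset.sum_congr rfl fun k _ => by rw [Complex.re_ofReal_mul, mul_comm]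
  have hone : udiag W (fun _ => 1) = 1 := by simp [udiag, hW']
  have hP1 : ∑ k, P k = 1 := by
    have := hPtr fun _ => 1
    rw [hone, mul_one, hρ.2] at this
    simpa using this.symm
  have hQ1 : ∑ k, Q k = 1 := by
    have := hQtr fun _ => 1
    rw [hone, mul_one, hρ'.2] at this
    simpa using this.symm
  have hQ0 : ∀ k, 0 ≤ Q k := fun k => by
    have := (hρ'.1.conjTranspose_mul_mul_same W).diag_nonneg (i := k)
    exact (Complex.le_def.1 this).1
  set Z : ℝ := (ρ' * NormedSpace.exp G).trace.re with hZ
  have hZs : Z = ∑ k, Q k * Real.exp (g k) := by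
    rw [hZ, hGW, exp_udiag hW, hQtr]
  have hZpos : 0 < Z := by
    rw [hZs]
    refine lt_of_le_of_ne (Finset.sum_nonneg fun k _ => mul_nonneg (hQ0 k) (Real.exp_pos _).le)
      fun h => ?_
    have h1 := (Finset.sum_eq_zero_iff_of_nonneg
      (fun k _ => mul_nonneg (hQ0 k) (Real.exp_pos (g k)).le)).1 h.symm
    have h2 : ∑ k, Q k = 0 := Finset.sum_eq_zero fun k hk =>
      (mul_eq_zero.1 (h1 k hk)).resolve_right (Real.exp_pos _).ne'
    linarith
  -- the weights of the relative modular operator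
  set M : n → n → ℝ := fun i j => Complex.normSq ((star V * U) j i) with hM
  have hM1 : ∀ i, ∑ j, M i j = 1 := fun i => by
    have h1 : star (star V * U) * (star V * U) = 1 := by
      simp only [star_mul, star_star, mul_assoc]
      rw [← mul_assoc V, hV', one_mul, hU]
    have h2 := congrFun (congrFun h1 i) i
    rw [Matrix.mul_apply, Matrix.one_apply_eq] at h2
    have h3 : ((∑ j, M i j : ℝ) : ℂ) = 1 := by
      rw [← h2]
      push_cast
      refine Finset.sum_congr rfl fun j _ => ?_
      rw [hM, Matrix.star_apply, Complex.star_def, Complex.normSq_eq_conj_mul_self]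
    exact_mod_cast h3
  have hMne : ∀ i j, M i j * p i ≠ 0 → 0 < p i ∧ 0 < q j := fun i j h => by
    have hpi : p i ≠ 0 := right_ne_zero_of_mul h
    refine ⟨(hp i).lt_of_ne' hpi, (hq j).lt_of_ne' fun hqj => left_ne_zero_of_mul h ?_⟩
    rw [hρU, hρV] at hsupp
    rw [hM]
    simp only
    rw [entry_eq_zero_of_supp_le hU hV hsupp hpi hqj, map_zero]
  have hp1 : ∑ i, p i = 1 := by
    have h1 := trace_udiag_mul U p 1
    rw [mul_one, ← hρU, hρ.2] at h1
    simp only [mul_one, hU, Matrix.one_apply_eq] at h1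
    exact_mod_cast h1.symm
  -- the entropy as a sum
  have hD : (ρ * (cfc Real.log ρ - cfc Real.log ρ')).trace.re
      = ∑ i, ∑ j, M i j * p i * (Real.log (p i) - Real.log (q j)) := by
    rw [mul_sub, Matrix.trace_sub, Complex.sub_re, hρf, hρf']
    have h1 : (ρ * udiag U fun i => Real.log (p i)).trace.re = ∑ i, p i * Real.log (p i) := by
      have h := trace_udiag_mul U (fun i => p i * Real.log (p i)) 1
      rw [mul_one, ← udiag_mul_udiag hU, ← hρU] at h
      rw [h, Complex.re_sum]
      simp [hU]
    have h2 : (ρ * udiag V fun i => Real.log (q i)).trace.re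
        = ∑ i, ∑ j, M i j * p i * Real.log (q j) := by
      rw [hρU, trace_udiag_mul, Complex.re_sum]
      refine Finset.sum_congr rfl fun i _ => ?_
      have h3 : star U * (udiag V fun i => Real.log (q i)) * U
          = star (star V * U) *
            (Matrix.diagonal (fun j => (Real.log (q j) : ℂ)) * (star V * U)) := by
        simp only [udiag, star_mul, star_star, mul_assoc]
      rw [h3, Complex.re_ofReal_mul, Matrix.mul_apply, Complex.re_sum, Finset.mul_sum]
      refine Finset.sum_congr rfl fun j _ => ?_
      rw [Matrix.diagonal_mul, Matrix.star_apply, Complex.star_def,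
        mul_left_comm, ← Complex.normSq_eq_conj_mul_self, Complex.re_ofReal_mul,
        Complex.ofReal_re, hM]
      ring
    rw [h1, h2, ← Finset.sum_sub_distrib]
    refine Finset.sum_congr rfl fun i _ => ?_
    simp only [mul_sub, Finset.sum_sub_distrib, ← Finset.sum_mul, hM1, one_mul]
  -- the integrated resolvent inequality
  set w : n × n → ℝ := fun x => M x.1 x.2 * p x.1 with hw
  -- The eigenvalues of the relative modular operator. The value 1 at weight 0 is arbitrary and only
  -- keeps `a` positive.
  set a : n × n → ℝ := fun x => if w x = 0 then 1 else q x.2 / p x.1 with ha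
  have ha0 : ∀ x, 0 < a x := fun x => by
    rw [ha]
    simp only
    split_ifs with h
    · exact one_pos
    · exact div_pos (hMne _ _ h).2 (hMne _ _ h).1
  -- The best choice would be Q/P, which yields monotonicity under measurement. The value Q/P takes
  -- in the equality case of the Gibbs principle gives the final bound directly and needs no
  -- positivity of P.
  set b : n → ℝ := fun k => Z * Real.exp (-g k) with hb
  have hb0 : ∀ k, 0 < b k := fun k => mul_pos hZpos (Real.exp_pos _)
  have hws : ∑ x, w x = ∑ k, P k := by
    rw [hP1, Fintype.sum_prod_type, ← hp1]
    refine Finset.sum_congr rfl fun i _ => ?_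
    simp only [hw, ← Finset.sum_mul, hM1, one_mul]
  have key := sum_mul_log_le w a P Q b ha0 hb0 hws ?_
  · have hl : ∑ x, w x * Real.log (a x)
        = -∑ i, ∑ j, M i j * p i * (Real.log (p i) - Real.log (q j)) := by
      rw [Fintype.sum_prod_type, ← Finset.sum_neg_distrib]
      refine Finset.sum_congr rfl fun i _ => ?_
      rw [← Finset.sum_neg_distrib]
      refine Finset.sum_congr rfl fun j _ => ?_
      simp only [ha, hw]
      split_ifs with h
      · simp [h]
      · rw [Real.log_div (hMne _ _ h).2.ne' (hMne _ _ h).1.ne']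
        ring
    have hr : ∑ k, (P k * Real.log (b k) - (P k - Q k / b k)) = Real.log Z - ∑ k, P k * g k := by
      have h1 : ∀ k, P k * Real.log (b k) - (P k - Q k / b k)
          = P k * Real.log Z - P k * g k - P k + Q k * Real.exp (g k) / Z := fun k => by
        rw [hb]
        simp only
        rw [Real.log_mul hZpos.ne' (Real.exp_pos _).ne', Real.log_exp, Real.exp_neg]
        field_simp
        ring
      simp only [h1, Finset.sum_add_distrib, Finset.sum_sub_distrib, ← Finset.sum_mul,
        ← Finset.sum_div, ← hZs, hP1, div_self hZpos.ne']
      ring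
    have hG' : (ρ * G).trace.re = ∑ k, P k * g k := by rw [hGW, hPtr]
    rw [hl, hr] at key
    rw [hD, hG']
    linarith
  · intro s hs
    -- The trial operator is diagonal in the eigenbasis of G, so ρ and ρ' enter only through their
    -- diagonals P and Q there.
    have h1 := resolvent_le (C := udiag W fun k => (b k + s)⁻¹) hU' hV' p q hp hq
      (star_udiag _ _) hs
    rw [← hρU, ← hρV, udiag_mul_udiag hW, hPtr, hPtr, hQtr] at h1
    have h2 : ∑ x, w x / (a x + s) = ∑ i, ∑ j, M i j * (p i ^ 2 / (q j + s * p i)) := by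
      rw [Fintype.sum_prod_type]
      refine Finset.sum_congr rfl fun i _ => Finset.sum_congr rfl fun j _ => ?_
      simp only [ha, hw]
      split_ifs with h
      · rw [h, zero_div, pow_two, mul_div_assoc, ← mul_assoc, h, zero_mul]
      · have h3 := (hMne _ _ h).1
        have h4 := (hMne _ _ h).2
        field_simp
    rw [h2]
    refine le_trans (le_of_eq ?_) h1
    rw [Finset.mul_sum, Finset.mul_sum, ← Finset.sum_sub_distrib, ← Finset.sum_sub_distrib]
    refine Finset.sum_congr rfl fun k _ => ?_
    have h5 : b k + s ≠ 0 := (add_pos (hb0 k) hs).ne'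
    field_simp
    ring

end Entropy

end RiskSensitive

noncomputable section

set_option linter.unusedSectionVars false

namespace RiskSensitive

/-! ### The field algebra as the functions of the signs of σ_x. -/

section Field

variable {κ : Type*} [Fintype κ] [DecidableEq κ] {N : ℕ}

/-! ### Product operators on the field -/

/-- The product operator `X₁ ⊗ ⋯ ⊗ X_N`. -/
def tens (X : Fin N → Matrix (Fin 2) (Fin 2) ℂ) : FieldOp N :=
  Matrix.of fun s t => ∏ k, X k (s k) (t k)

lemma tens_mul (X Y : Fin N → Matrix (Fin 2) (Fin 2) ℂ) :
    tens X * tens Y = tens (fun k => X k * Y k) := by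
  ext s t
  simp only [tens, Matrix.mul_apply, Matrix.of_apply, Finset.prod_univ_sum, Fintype.piFinset_univ,
    Finset.prod_mul_distrib]

lemma star_tens (X : Fin N → Matrix (Fin 2) (Fin 2) ℂ) :
    star (tens X) = tens (fun k => star (X k)) := by
  ext s t
  simp [tens, Matrix.star_apply]

lemma tens_one : tens (fun _ : Fin N => (1 : Matrix (Fin 2) (Fin 2) ℂ)) = 1 := by
  ext s t
  rw [tens, Matrix.of_apply]
  by_cases h : s = t
  · subst h
    simp
  · obtain ⟨k, hk⟩ := Function.ne_iff.1 h
    rw [Matrix.one_apply_ne h]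
    exact Finset.prod_eq_zero (Finset.mem_univ k) (Matrix.one_apply_ne hk)

lemma tens_sum (X : Fin N → Fin 2 → Matrix (Fin 2) (Fin 2) ℂ) :
    tens (fun k => ∑ j, X k j) = ∑ t : Fin N → Fin 2, tens (fun k => X k (t k)) := by
  ext s t
  simp only [tens, Matrix.of_apply, Matrix.sum_apply, Finset.prod_univ_sum, Fintype.piFinset_univ]

lemma tens_smul (a : Fin N → ℂ) (X : Fin N → Matrix (Fin 2) (Fin 2) ℂ) :
    tens (fun k => a k • X k) = (∏ k, a k) • tens X := by
  ext s t
  simp [tens, Finset.prod_mul_distrib]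

lemma tens_eq_zero {X : Fin N → Matrix (Fin 2) (Fin 2) ℂ} (k : Fin N) (h : X k = 0) :
    tens X = 0 := by
  ext s t
  rw [tens, Matrix.of_apply]
  exact Finset.prod_eq_zero (Finset.mem_univ k) (by rw [h]; rfl)

lemma trace_tens (X : Fin N → Matrix (Fin 2) (Fin 2) ℂ) :
    (tens X).trace = ∏ k, (X k).trace := by
  simp only [tens, Matrix.trace, Matrix.diag, Matrix.of_apply, Finset.prod_univ_sum,
    Fintype.piFinset_univ]

lemma slice_eq_tens (l : ℕ) (X : Matrix (Fin 2) (Fin 2) ℂ) :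
    slice N l X = tens (fun k => if (k : ℕ) + 1 = l then X else 1) := rfl

lemma slice_mul (l : ℕ) (X Y : Matrix (Fin 2) (Fin 2) ℂ) :
    slice N l X * slice N l Y = slice N l (X * Y) := by
  simp only [slice_eq_tens, tens_mul]
  congr 1
  ext1 k
  split_ifs <;> simp

lemma slice_commute {l k : ℕ} (h : l ≠ k) (X Y : Matrix (Fin 2) (Fin 2) ℂ) :
    Commute (slice N l X) (slice N k Y) := by
  rw [Commute, SemiconjBy]
  simp only [slice_eq_tens, tens_mul]
  congr 1
  ext1 i
  split_ifs with h1 h2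
  · exact absurd (h1.symm.trans h2) h
  all_goals simp

lemma slice_one (l : ℕ) : slice N l 1 = 1 := by
  rw [slice_eq_tens, ← tens_one]
  simp

/-- The bounds matter: for l outside 1, …, N every slice operator is I, and additivity fails. -/
lemma slice_add {l : ℕ} (h1 : 1 ≤ l) (hl : l ≤ N) (X Y : Matrix (Fin 2) (Fin 2) ℂ) :
    slice N l (X + Y) = slice N l X + slice N l Y := by
  let i : Fin N := ⟨l - 1, by omega⟩
  have hi : (i : ℕ) + 1 = l := by simp only [i]; omega
  have hne : ∀ k ∈ Finset.univ.erase i, ¬ ((k : ℕ) + 1 = l) := fun k hk h =>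
    (Finset.mem_erase.1 hk).1 (Fin.ext (by omega))
  ext s t
  simp only [slice, Matrix.of_apply, Matrix.add_apply]
  simp only [← Finset.mul_prod_erase Finset.univ _ (Finset.mem_univ i), hi, if_true,
    Matrix.add_apply, add_mul]
  congr 2 <;>
  exact Finset.prod_congr rfl fun k hk => by rw [if_neg (hne k hk), if_neg (hne k hk)]

lemma vacuumProj_eq_tens :
    vacuumProj N = tens (fun _ => Matrix.vecMulVec vacuum (star vacuum)) := by
  ext s t
  simp [vacuumProj, tens, Matrix.vecMulVec_apply, Finset.prod_mul_distrib]

lemma vacuum_dot : star vacuum ⬝ᵥ vacuum = 1 := by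
  simp [dotProduct, Fin.sum_univ_two, vacuum]

lemma vacuumProj_mul_self : vacuumProj N * vacuumProj N = vacuumProj N := by
  rw [vacuumProj_eq_tens, tens_mul]
  congr 1
  ext1 k
  rw [Matrix.vecMulVec_mul_vecMulVec, vacuum_dot, one_smul]

lemma star_vacuumProj : star (vacuumProj N) = vacuumProj N := by
  rw [vacuumProj, Matrix.star_eq_conjTranspose, Matrix.conjTranspose_vecMulVec, star_star]

lemma slice_sigmaMinus_mul_vacuumProj {l : ℕ} (h1 : 1 ≤ l) (hl : l ≤ N) :
    slice N l sigmaMinus * vacuumProj N = 0 := by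
  rw [vacuumProj_eq_tens, slice_eq_tens, tens_mul]
  refine tens_eq_zero ⟨l - 1, by omega⟩ ?_
  rw [if_pos (by simp only []; omega), Matrix.mul_vecMulVec]
  ext i j
  fin_cases i <;> fin_cases j <;> simp [sigmaMinus, vacuum, Matrix.vecMulVec_apply]

/-! ### Embeddings into the total space -/

lemma embSys_one : (embSys 1 : TotOp κ N) = 1 := by simp [embSys]

lemma star_embSys (X : SysOp κ) : star (embSys X : TotOp κ N) = embSys (star X) := by
  simp [embSys, Matrix.star_eq_conjTranspose, Matrix.conjTranspose_kronecker]

lemma embField_mul (X Y : FieldOp N) :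
    (embField (X * Y) : TotOp κ N) = embField X * embField Y := by
  simp [embField, ← Matrix.mul_kronecker_mul]

lemma embField_one : (embField 1 : TotOp κ N) = 1 := by simp [embField]

lemma embField_zero : (embField 0 : TotOp κ N) = 0 := by simp [embField]

lemma embField_add (X Y : FieldOp N) :
    (embField (X + Y) : TotOp κ N) = embField X + embField Y :=
  Matrix.kronecker_add _ _ _

lemma embField_sum {ι : Type*} (s : Finset ι) (X : ι → FieldOp N) :
    (embField (∑ i ∈ s, X i) : TotOp κ N) = ∑ i ∈ s, embField (X i) :=
  map_sum (AddMonoidHom.mk' (embField : FieldOp N → TotOp κ N) embField_add) X s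

lemma embField_smul (c : ℂ) (X : FieldOp N) :
    (embField (c • X) : TotOp κ N) = c • embField X :=
  Matrix.kronecker_smul _ _ _

lemma star_embField (X : FieldOp N) : star (embField X : TotOp κ N) = embField (star X) := by
  simp [embField, Matrix.star_eq_conjTranspose, Matrix.conjTranspose_kronecker]

lemma embSys_mul_embField (X : SysOp κ) (Y : FieldOp N) :
    (embSys X * embField Y : TotOp κ N) = X ⊗ₖ Y := by
  simp [embSys, embField, ← Matrix.mul_kronecker_mul]

lemma embSys_commute (X : SysOp κ) (Y : FieldOp N) :
    Commute (embSys X : TotOp κ N) (embField Y) := by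
  simp [Commute, SemiconjBy, embSys, embField, ← Matrix.mul_kronecker_mul]

/-! ### The joint spectral resolution of `σ_x` in all slices -/

/-- The eigenvalues `1, -1` of `σ_x`. -/
def signVal (i : Fin 2) : ℂ := if i = 0 then 1 else -1

/-- The spectral projections of `σ_x`. -/
def signProj (i : Fin 2) : Matrix (Fin 2) (Fin 2) ℂ :=
  !![1 / 2, signVal i / 2; signVal i / 2, 1 / 2]

lemma signProj_mul (i j : Fin 2) : signProj i * signProj j = if i = j then signProj i else 0 := by
  fin_cases i <;> fin_cases j <;> ext a b <;> fin_cases a <;> fin_cases b <;>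
    simp [signProj, signVal, Matrix.mul_apply] <;> norm_num

lemma sum_signProj : ∑ i, signProj i = 1 := by
  ext a b
  fin_cases a <;> fin_cases b <;> simp [signProj, signVal] <;> norm_num

lemma sum_signVal_smul_signProj : ∑ i, signVal i • signProj i = sigmaMinus + sigmaPlus := by
  ext a b
  fin_cases a <;> fin_cases b <;> simp [signProj, signVal, sigmaMinus, sigmaPlus] <;> norm_num

lemma star_signProj (i : Fin 2) : star (signProj i) = signProj i := by
  ext a b
  fin_cases i <;> fin_cases a <;> fin_cases b <;> simp [signProj, signVal, Matrix.star_apply]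

lemma trace_signProj_mul_vacuum (i : Fin 2) :
    (signProj i * Matrix.vecMulVec vacuum (star vacuum)).trace = 1 / 2 := by
  rw [Matrix.mul_vecMulVec, Matrix.trace_vecMulVec]
  fin_cases i <;> simp [signProj, vacuum, Matrix.mulVec, dotProduct, Fin.sum_univ_two]

/-- The joint spectral projections. -/
def fieldProj (t : Fin N → Fin 2) : FieldOp N := tens (fun k => signProj (t k))

lemma fieldProj_mul (t t' : Fin N → Fin 2) :
    fieldProj t * fieldProj t' = if t = t' then fieldProj t else 0 := by
  rw [fieldProj, fieldProj, tens_mul]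
  split_ifs with h
  · subst h
    simp [signProj_mul]
  · obtain ⟨k, hk⟩ := Function.ne_iff.1 h
    exact tens_eq_zero k (by rw [signProj_mul, if_neg hk])

lemma sum_fieldProj : ∑ t : Fin N → Fin 2, fieldProj t = 1 := by
  simp only [fieldProj]
  rw [← tens_sum fun _ => signProj]
  simp only [sum_signProj, tens_one]

lemma star_fieldProj (t : Fin N → Fin 2) : star (fieldProj t) = fieldProj t := by
  simp only [fieldProj, star_tens, star_signProj]

/-- Insert the spectral resolution of σ_x in one factor and of I in the others, and expand the
tensor product. -/
lemma slice_eq_sum {l : ℕ} (i : Fin N) (hi : (i : ℕ) + 1 = l) :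
    slice N l (sigmaMinus + sigmaPlus) = ∑ t : Fin N → Fin 2, signVal (t i) • fieldProj t := by
  have h : ∀ t : Fin N → Fin 2, signVal (t i) • fieldProj t
      = tens (fun k => (if (k : ℕ) + 1 = l then signVal (t k) else 1) • signProj (t k)) := by
    intro t
    rw [tens_smul, fieldProj]
    congr 1
    rw [Finset.prod_eq_single i]
    · rw [if_pos hi]
    · intro k _ hk
      rw [if_neg fun h => hk (Fin.ext (by omega))]
    · simp
  simp only [h]
  rw [← tens_sum fun k j => (if (k : ℕ) + 1 = l then signVal j else 1) • signProj j, slice_eq_tens]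
  congr 1
  ext1 k
  split_ifs
  · rw [sum_signVal_smul_signProj]
  · simp only [one_smul, sum_signProj]

lemma trace_fieldProj_mul_vacuumProj (t : Fin N → Fin 2) :
    (fieldProj t * vacuumProj N).trace = (1 / 2) ^ N := by
  rw [fieldProj, vacuumProj_eq_tens, tens_mul, trace_tens]
  simp only [trace_signProj_mul_vacuum, Finset.prod_const, Finset.card_univ, Fintype.card_fin]

/-- Block diagonal operators with respect to the joint spectral resolution. -/
def blockHom : ((Fin N → Fin 2) → SysOp κ) →⋆ₐ[ℂ] TotOp κ N where
  toFun f := ∑ t, f t ⊗ₖ fieldProj t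
  map_one' := by
    simp only [Pi.one_apply]
    change ∑ t, embField (fieldProj t) = (1 : TotOp κ N)
    rw [← embField_sum, sum_fieldProj, embField_one]
  map_mul' f g := by
    simp only [Finset.sum_mul, Finset.mul_sum, ← Matrix.mul_kronecker_mul, fieldProj_mul]
    refine Finset.sum_congr rfl fun t _ => ?_
    rw [Finset.sum_eq_single t]
    · simp
    · intro t' _ h
      rw [if_neg h, Matrix.kronecker_zero]
    · simp
  map_zero' := by simp
  map_add' f g := by simp [Matrix.add_kronecker, Finset.sum_add_distrib]
  commutes' r := by
    simp only [Pi.algebraMap_apply, Algebra.algebraMap_eq_smul_one, Matrix.smul_kronecker]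
    rw [← Finset.smul_sum]
    change r • ∑ t, embField (fieldProj t) = r • (1 : TotOp κ N)
    rw [← embField_sum, sum_fieldProj, embField_one]
  map_star' f := by
    simp only [star_sum, Pi.star_apply, Matrix.star_eq_conjTranspose,
      Matrix.conjTranspose_kronecker]
    refine Finset.sum_congr rfl fun t _ => ?_
    rw [← Matrix.star_eq_conjTranspose (fieldProj t), star_fieldProj]

variable {l : ℕ}

/-- The restriction of a configuration to the first `l` slices. -/
def restrict (hl : l ≤ N) (t : Fin N → Fin 2) (k : Fin l) : Fin 2 := t (Fin.castLE hl k)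

lemma restrict_surjective (hl : l ≤ N) : Function.Surjective (restrict hl) := fun s =>
  ⟨fun k => if h : (k : ℕ) < l then s ⟨k, h⟩ else 0, by ext k; simp [restrict]⟩

/-- Block diagonal operators depending only on the first `l` slices. -/
def cylBlock (hl : l ≤ N) : ((Fin l → Fin 2) → SysOp κ) →⋆ₐ[ℂ] TotOp κ N :=
  blockHom.comp
    { toFun := fun f t => f (restrict hl t)
      map_one' := rfl
      map_mul' := fun _ _ => rfl
      map_zero' := rfl
      map_add' := fun _ _ => rfl
      commutes' := fun _ => rfl
      map_star' := fun _ => rfl }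

lemma cylBlock_apply (hl : l ≤ N) (f : (Fin l → Fin 2) → SysOp κ) :
    cylBlock hl f = ∑ t, f (restrict hl t) ⊗ₖ fieldProj t := rfl

/-- Functions of `σ_x` in the first `l` slices. -/
def cyl (hl : l ≤ N) : ((Fin l → Fin 2) → ℂ) →⋆ₐ[ℂ] TotOp κ N :=
  (cylBlock hl).comp
    { toFun := fun c s => c s • 1
      map_one' := by ext1; simp
      map_mul' := fun c d => by ext1; simp [smul_smul, mul_comm]
      map_zero' := by ext1; simp
      map_add' := fun c d => by ext1; simp [add_smul]
      commutes' := fun r => by ext1; simp [Algebra.algebraMap_eq_smul_one]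
      map_star' := fun c => by ext1; simp }

lemma cyl_eq_cylBlock (hl : l ≤ N) (c : (Fin l → Fin 2) → ℂ) :
    (cyl hl c : TotOp κ N) = cylBlock hl (fun s => c s • 1) := rfl

lemma cyl_eq_embField (hl : l ≤ N) (c : (Fin l → Fin 2) → ℂ) :
    (cyl hl c : TotOp κ N) = embField (∑ t, c (restrict hl t) • fieldProj t) := by
  rw [cyl_eq_cylBlock, cylBlock_apply, embField_sum]
  refine Finset.sum_congr rfl fun t _ => ?_
  rw [Matrix.smul_kronecker, embField_smul]
  rfl

lemma embSys_eq_cylBlock (hl : l ≤ N) (X : SysOp κ) :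
    (embSys X : TotOp κ N) = cylBlock hl (fun _ => X) := by
  rw [cylBlock_apply]
  have : ∀ t : Fin N → Fin 2, X ⊗ₖ fieldProj t = (embSys X * embField (fieldProj t) : TotOp κ N) :=
    fun t => (embSys_mul_embField X _).symm
  simp only [this]
  rw [← Finset.mul_sum, ← embField_sum, sum_fieldProj, embField_one, mul_one]

lemma cylBlock_mul_cyl_single (hl : l ≤ N) (f : (Fin l → Fin 2) → SysOp κ) (s : Fin l → Fin 2) :
    cylBlock hl f * cyl hl (Pi.single s 1)
      = (embSys (f s) * cyl hl (Pi.single s 1) : TotOp κ N) := by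
  rw [embSys_eq_cylBlock hl, cyl_eq_cylBlock, ← map_mul, ← map_mul]
  congr 1
  ext1 s'
  by_cases h : s' = s
  · subst h; rfl
  · simp [Pi.single_apply, h]

/-- The state of a spectral projection of the first `l` slices. -/
def cylWeight (hl : l ≤ N) (s : Fin l → Fin 2) : ℝ :=
  ∑ t : Fin N → Fin 2, if restrict hl t = s then (1 / 2) ^ N else 0

/-- No configuration is null in the reference state, whatever ρ is. Hence conditional expectations
onto 𝒞_l, and with them the filters, are unique and not merely almost surely so. -/
lemma cylWeight_pos (hl : l ≤ N) (s : Fin l → Fin 2) : 0 < cylWeight hl s := by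
  obtain ⟨t, ht⟩ := restrict_surjective hl s
  refine Finset.sum_pos' (fun t _ => by split_ifs <;> positivity) ⟨t, Finset.mem_univ t, ?_⟩
  rw [if_pos ht]
  positivity

/-- The state, as a linear functional. -/
def stateLin (ρ : SysOp κ) : TotOp κ N →ₗ[ℂ] ℂ where
  toFun := stateOf ρ
  map_add' A B := by simp [stateOf, add_mul]
  map_smul' c A := by simp [stateOf]

lemma stateLin_cyl_single (hl : l ≤ N) {ρ : SysOp κ} (hρ : ρ.trace = 1) (s : Fin l → Fin 2) :
    stateLin ρ (cyl hl (Pi.single s 1) : TotOp κ N) = (cylWeight hl s : ℂ) := by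
  change stateOf ρ (cyl hl (Pi.single s 1)) = (cylWeight hl s : ℂ)
  rw [cyl_eq_embField, stateOf, embField, ← Matrix.mul_kronecker_mul, Matrix.trace_kronecker,
    one_mul, hρ, one_mul, Finset.sum_mul, Matrix.trace_sum, cylWeight]
  push_cast
  refine Finset.sum_congr rfl fun t _ => ?_
  rw [Matrix.smul_mul, Matrix.trace_smul, trace_fieldProj_mul_vacuumProj]
  by_cases h : restrict hl t = s
  · simp [h]
  · simp [h]

namespace Model

variable (m : Model κ N)

lemma dW_eq (hl : l ≤ N) (k : Fin l) :
    m.dW ((k : ℕ) + 1) = cyl hl (fun s => (m.lam : ℂ) * signVal (s k)) := by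
  have h : m.dW ((k : ℕ) + 1)
      = embField ((m.lam : ℂ) • slice N ((k : ℕ) + 1) (sigmaMinus + sigmaPlus)) := by
    rw [slice_add (by omega) (by omega), smul_add, embField_add]
    rfl
  rw [h, slice_eq_sum (l := (k : ℕ) + 1) (Fin.castLE hl k) rfl, cyl_eq_embField, Finset.smul_sum]
  simp only [smul_smul]
  rfl

/-- The generators are λ times the sign functions, and since λ ≠ 0 these generate the indicator of
every configuration. -/
lemma mem_fieldAlg (hl : l ≤ N) (A : TotOp κ N) : A ∈ m.fieldAlg l ↔ ∃ c, cyl hl c = A := by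
  constructor
  · intro h
    have h1 : m.fieldAlg l ≤ (cyl hl : _ →⋆ₐ[ℂ] TotOp κ N).range := by
      refine StarAlgebra.adjoin_le ?_
      rintro _ ⟨i, h1, h2, rfl⟩
      obtain ⟨j, rfl⟩ : ∃ j, i = j + 1 := ⟨i - 1, by omega⟩
      exact ⟨_, (m.dW_eq hl ⟨j, by omega⟩).symm⟩
    exact h1 h
  · rintro ⟨c, rfl⟩
    let D : StarSubalgebra ℂ ((Fin l → Fin 2) → ℂ) := (m.fieldAlg l).comap (cyl hl)
    have hsign : ∀ k : Fin l, (fun s : Fin l → Fin 2 => signVal (s k)) ∈ D := by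
      intro k
      have h1 : (fun s : Fin l → Fin 2 => (m.lam : ℂ) * signVal (s k)) ∈ D := by
        change cyl hl _ ∈ m.fieldAlg l
        rw [← m.dW_eq hl k]
        exact StarAlgebra.subset_adjoin _ _ ⟨k + 1, by omega, by omega, rfl⟩
      have h2 := D.smul_mem h1 ((m.lam : ℂ)⁻¹)
      have h3 : (m.lam : ℂ) ≠ 0 := by exact_mod_cast m.lam_pos.ne'
      convert h2 using 1
      ext s
      simp [h3]
    have hsingle : ∀ s : Fin l → Fin 2, (Pi.single s 1 : (Fin l → Fin 2) → ℂ) ∈ D := by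
      intro s
      -- For signs a, b = ±1 the number (1 + ab)/2 is the indicator of a = b.
      have h1 : (∏ k, ((1 / 2 : ℂ) •
          (1 + signVal (s k) • fun s' : Fin l → Fin 2 => signVal (s' k))))
          ∈ D := prod_mem fun k _ => D.smul_mem (D.add_mem D.one_mem (D.smul_mem (hsign k) _)) _
      convert h1 using 1
      ext s'
      rw [Finset.prod_apply]
      have h2 : ∀ a b : Fin 2, ((1 / 2 : ℂ) * (1 + signVal a * signVal b))
          = if b = a then 1 else 0 := by
        intro a b
        fin_cases a <;> fin_cases b <;> simp [signVal] <;> norm_num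
      have h3 : ∀ k : Fin l, ((1 / 2 : ℂ) • (1 + signVal (s k) •
          fun s' : Fin l → Fin 2 => signVal (s' k))) s' = if s' k = s k then 1 else 0 :=
        fun k => h2 (s k) (s' k)
      simp only [h3]
      by_cases h : s' = s
      · subst h; simp
      · obtain ⟨k, hk⟩ := Function.ne_iff.1 h
        rw [Pi.single_eq_of_ne h]
        exact (Finset.prod_eq_zero (Finset.mem_univ k) (if_neg hk)).symm
    have h1 : c = ∑ s, c s • (Pi.single s 1 : (Fin l → Fin 2) → ℂ) := by
      ext s
      simp [Finset.sum_apply, Pi.single_apply]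
    change c ∈ D
    rw [h1]
    exact sum_mem fun s _ => D.smul_mem (hsingle s) _

end Model

/-- Versions of the conditional expectation onto an algebra of functions on a finite set. -/
lemma isCondExp_iff {n S : Type*} [Fintype n] [DecidableEq n] [Fintype S] [DecidableEq S]
    (P : Matrix n n ℂ →ₗ[ℂ] ℂ) {C : StarSubalgebra ℂ (Matrix n n ℂ)}
    (Ψ : (S → ℂ) →⋆ₐ[ℂ] Matrix n n ℂ) (hΨ : ∀ A, A ∈ C ↔ ∃ c, Ψ c = A) (A : Matrix n n ℂ)
    (c : S → ℂ) (E : C) (hE : Ψ c = E) :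
    IsCondExp P C A E ↔ (∀ d, Commute A (Ψ d)) ∧
      ∀ s, c s * P (Ψ (Pi.single s 1)) = P (A * Ψ (Pi.single s 1)) := by
  have hmul : ∀ s, Ψ c * Ψ (Pi.single s 1) = c s • Ψ (Pi.single s 1) := fun s => by
    rw [← map_mul, ← map_smul]
    congr 1
    ext s'
    by_cases h : s' = s
    · subst h; simp
    · simp [h]
  constructor
  · rintro ⟨h1, h2⟩
    refine ⟨fun d => h1 ⟨Ψ d, (hΨ _).2 ⟨d, rfl⟩⟩, fun s => ?_⟩
    have := h2 ⟨Ψ (Pi.single s 1), (hΨ _).2 ⟨_, rfl⟩⟩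
    rw [← hE] at this
    simp only at this
    rw [hmul, map_smul, smul_eq_mul] at this
    exact this
  · rintro ⟨h1, h2⟩
    refine ⟨fun K => ?_, fun K => ?_⟩
    · obtain ⟨d, hd⟩ := (hΨ _).1 K.2
      rw [← hd]
      exact h1 d
    · obtain ⟨d, hd⟩ := (hΨ _).1 K.2
      have h3 : d = ∑ s, d s • (Pi.single s 1 : S → ℂ) := by
        ext s
        simp [Finset.sum_apply, Pi.single_apply]
      rw [← hd, ← hE, h3]
      simp only [map_sum, map_smul, Finset.mul_sum, mul_smul_comm, hmul, h2, smul_eq_mul]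

end Field

end RiskSensitive

end

noncomputable section

set_option linter.unusedSectionVars false

namespace RiskSensitive

/-! ### Replacing U by V and UR by V^μ on the vacuum. -/

section Dynamics

variable {κ : Type*} [Fintype κ] [DecidableEq κ] {N : ℕ}

lemma embField_commute {X Y : FieldOp N} (h : Commute X Y) :
    Commute (embField X : TotOp κ N) (embField Y) := by
  rw [Commute, SemiconjBy, ← embField_mul, ← embField_mul, h.eq]

/-- The vacuum projection on the total space. -/
def vac (κ : Type*) [Fintype κ] [DecidableEq κ] (N : ℕ) : TotOp κ N := embField (vacuumProj N)

lemma kronecker_vacuumProj (ρ : SysOp κ) :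
    ρ ⊗ₖ vacuumProj N = vac κ N * embSys ρ * vac κ N := by
  rw [vac, ← (embSys_commute ρ (vacuumProj N)).eq, mul_assoc, ← embField_mul, vacuumProj_mul_self,
    embSys_mul_embField]

lemma star_vac : star (vac κ N) = vac κ N := by
  rw [vac, star_embField, star_vacuumProj]

/-- Operators that agree on the vacuum define the same transformed state. -/
lemma stateOf_conj_congr (ρ : SysOp κ) {v w : TotOp κ N} (h : v * vac κ N = w * vac κ N)
    (A : TotOp κ N) : stateOf ρ (star v * A * v) = stateOf ρ (star w * A * w) := by
  have key : ∀ z : TotOp κ N, stateOf ρ (star z * A * z)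
      = (star (z * vac κ N) * A * (z * vac κ N) * embSys ρ).trace := fun z => by
    rw [stateOf, kronecker_vacuumProj, ← mul_assoc, Matrix.trace_mul_comm, star_mul, star_vac]
    simp only [mul_assoc]
  rw [key, key, h]

namespace Model

variable (m : Model κ N)

lemma dt_eq (l : ℕ) : m.dt l = ((m.lam : ℂ) ^ 2) • (1 : TotOp κ N) := by
  rw [dt, slice_one, embField_smul, embField_one]

lemma commute_dt (l : ℕ) (A : TotOp κ N) : Commute A (m.dt l) := by
  rw [dt_eq]
  exact (Commute.one_right A).smul_right _

lemma commute_dA {l : ℕ} {B : TotOp κ N} (h : ∀ X, Commute B (embField (slice N l X))) :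
    Commute B (m.dA l) := by
  rw [dA, embField_smul]
  exact (h _).smul_right _

lemma commute_dAstar {l : ℕ} {B : TotOp κ N} (h : ∀ X, Commute B (embField (slice N l X))) :
    Commute B (m.dAstar l) := by
  rw [dAstar, embField_smul]
  exact (h _).smul_right _

lemma commute_dW {l : ℕ} {B : TotOp κ N} (h : ∀ X, Commute B (embField (slice N l X))) :
    Commute B (m.dW l) :=
  (m.commute_dA h).add_right (m.commute_dAstar h)

lemma embSys_commute_dW (Y : SysOp κ) (l : ℕ) : Commute (embSys Y) (m.dW l) :=
  m.commute_dW fun _ => embSys_commute _ _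

lemma dW_commute_slice {j k : ℕ} (h : j ≠ k) (X : Matrix (Fin 2) (Fin 2) ℂ) :
    Commute (m.dW j) (embField (slice N k X)) :=
  (m.commute_dW fun _ => embField_commute (slice_commute h.symm _ _)).symm

lemma dW_commute_dW (j k : ℕ) : Commute (m.dW j) (m.dW k) := by
  by_cases h : j = k
  · rw [h]
  · exact m.commute_dW fun X => m.dW_commute_slice h X

lemma star_dW (l : ℕ) : star (m.dW l) = m.dW l := by
  have h1 : star (slice N l sigmaMinus) = slice N l sigmaPlus := by
    rw [slice_eq_tens, star_tens, slice_eq_tens]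
    congr 1
    ext1 k
    split_ifs
    · ext i j
      fin_cases i <;> fin_cases j <;> simp [sigmaMinus, sigmaPlus, Matrix.star_apply]
    · exact star_one _
  have h2 : star (m.dA l) = m.dAstar l := by
    simp [dA, dAstar, star_embField, h1]
  rw [dW, star_add, h2, ← h2, star_star, add_comm]

lemma step_commute_slice {j k : ℕ} (h : j ≠ k) (X : Matrix (Fin 2) (Fin 2) ℂ) :
    Commute (m.step j) (embField (slice N k X)) := by
  have hs : ∀ Y, Commute (embField (slice N k X) : TotOp κ N) (embField (slice N j Y)) :=
    fun Y => embField_commute (slice_commute h.symm _ _)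
  refine ((((Commute.one_left _).add_left ?_).add_left ?_).add_left ?_).add_left ?_
  · exact (embSys_commute _ _).mul_left (hs _).symm
  · exact (embSys_commute _ _).mul_left (m.commute_dAstar hs).symm
  · exact (embSys_commute _ _).mul_left (m.commute_dA hs).symm
  · exact (embSys_commute _ _).mul_left (m.commute_dt _ _).symm

lemma U_commute_slice {j k : ℕ} (h : j < k) (X : Matrix (Fin 2) (Fin 2) ℂ) :
    Commute (m.U j) (embField (slice N k X)) := by
  induction j with
  | zero => exact Commute.one_left _
  | succ j ih => exact (m.step_commute_slice h.ne X).mul_left (ih (by omega))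

/-- The transition operator of the reference process. -/
def vstep (l : ℕ) : TotOp κ N :=
  1 + (embSys (compose m.Mplus m.p) * m.dW l + embSys (compose m.Mcirc m.p) * m.dt l)

lemma V_succ (l : ℕ) : m.V (l + 1) = m.vstep (l + 1) * m.V l := by
  rw [V, vstep, add_mul 1, one_mul]

lemma vstep_commute {l : ℕ} {B : TotOp κ N} (h : ∀ Y, Commute (embSys Y) B)
    (h' : Commute (m.dW l) B) : Commute (m.vstep l) B :=
  (Commute.one_left _).add_left (((h _).mul_left h').add_left
    ((h _).mul_left (m.commute_dt _ _).symm))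

lemma V_commute {l : ℕ} {B : TotOp κ N} (h : ∀ Y, Commute (embSys Y) B)
    (h' : ∀ i, 1 ≤ i → i ≤ l → Commute (m.dW i) B) : Commute (m.V l) B := by
  induction l with
  | zero => exact Commute.one_left _
  | succ l ih =>
    rw [V_succ]
    exact (m.vstep_commute h (h' _ (by omega) le_rfl)).mul_left
      (ih fun i h1 h2 => h' i h1 (by omega))

/-- On the vacuum the interaction acts like the transition operator of the reference process. -/
lemma step_mul_vac {l : ℕ} (h1 : 1 ≤ l) (hl : l ≤ N) {B : TotOp κ N}
    (hB : ∀ X, Commute B (embField (slice N l X))) :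
    m.step l * (B * vac κ N) = m.vstep l * (B * vac κ N) := by
  -- σ₋ passes through B and annihilates the vacuum. So the ΔΛ and ΔA terms drop out, and M⁺ΔA may
  -- be added to complete M⁺ΔA* to M⁺ΔW.
  have hA : embField (slice N l sigmaMinus) * (B * vac κ N) = 0 := by
    rw [← mul_assoc, ← (hB _).eq, mul_assoc, vac, ← embField_mul,
      slice_sigmaMinus_mul_vacuumProj h1 hl, embField_zero, mul_zero]
  have h2 : m.dA l * (B * vac κ N) = 0 := by
    rw [dA, embField_smul, smul_mul_assoc, hA, smul_zero]
  have h3 : m.dLambda l * (B * vac κ N) = 0 := by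
    rw [dLambda, ← slice_mul, embField_mul, mul_assoc, hA, mul_zero]
  simp only [step, vstep, dW, add_mul, mul_add, mul_assoc, h2, h3, mul_zero, zero_add, add_zero,
    one_mul]
  abel

/-- U(l-1) acts trivially on slice l, so the vacuum of that slice is still available when M_l acts.
The gain is that V(l) commutes with 𝒞_l. -/
lemma U_mul_vac {l : ℕ} (hl : l ≤ N) : m.U l * vac κ N = m.V l * vac κ N := by
  induction l with
  | zero => rfl
  | succ l ih =>
    rw [U, mul_assoc, m.step_mul_vac (by omega) hl fun X => m.U_commute_slice (by omega) X,
      ih (by omega), V_succ, mul_assoc]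

lemma fieldAlg_commute {l : ℕ} {B : TotOp κ N}
    (h : ∀ i, 1 ≤ i → i ≤ l → Commute (m.dW i) B) {A : TotOp κ N} (hA : A ∈ m.fieldAlg l) :
    Commute A B := by
  have h1 : m.fieldAlg l ≤ StarSubalgebra.centralizer ℂ {B} := by
    refine StarAlgebra.adjoin_le ?_
    rintro _ ⟨i, h1, h2, rfl⟩
    rw [SetLike.mem_coe, StarSubalgebra.mem_centralizer_iff]
    rintro _ rfl
    refine ⟨(h i h1 h2).eq.symm, ?_⟩
    -- The centralizer as a star subalgebra also asks for commutation with B*; this is the adjoint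
    -- relation, ΔW(i) being selfadjoint.
    have h3 := congrArg star (h i h1 h2).eq
    rw [star_mul, star_mul, star_dW] at h3
    exact h3
  exact ((StarSubalgebra.mem_centralizer_iff ℂ).1 (h1 hA) B rfl).1.symm

variable {m}

lemma IsUnitary.U_mem (hm : m.IsUnitary) {l : ℕ} (hl : l ≤ N) :
    m.U l ∈ Matrix.unitaryGroup ((κ × Fin 2) × (Fin N → Fin 2)) ℂ := by
  induction l with
  | zero => exact one_mem _
  | succ l ih => exact mul_mem (hm _ (by omega) hl) (ih (by omega))

lemma IsUnitary.star_U_mul_U (hm : m.IsUnitary) {l : ℕ} (hl : l ≤ N) : star (m.U l) * m.U l = 1 :=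
  Matrix.mem_unitaryGroup_iff'.1 (hm.U_mem hl)

lemma IsUnitary.U_mul_star_U (hm : m.IsUnitary) {l : ℕ} (hl : l ≤ N) : m.U l * star (m.U l) = 1 :=
  Matrix.mem_unitaryGroup_iff.1 (hm.U_mem hl)

/-- Interactions after time i commute with ΔW(i) and cancel by unitarity. Hence a single conjugation
by U(l) carries all of 𝒞_l onto 𝒴_l. -/
lemma IsUnitary.dY_eq (hm : m.IsUnitary) {i l : ℕ} (hil : i ≤ l) (hl : l ≤ N) :
    m.dY i = star (m.U l) * m.dW i * m.U l := by
  induction l, hil using Nat.le_induction with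
  | base => rfl
  | succ l hil ih =>
    have h2 : star (m.step (l + 1)) * m.step (l + 1) = 1 :=
      Matrix.mem_unitaryGroup_iff'.1 (hm _ (by omega) hl)
    have h3 : Commute (m.step (l + 1)) (m.dW i) :=
      m.commute_dW fun X => m.step_commute_slice (by omega) X
    rw [ih (by omega), U, star_mul]
    have h4 : star (m.U l) * star (m.step (l + 1)) * m.dW i * (m.step (l + 1) * m.U l)
        = star (m.U l) * (star (m.step (l + 1)) * (m.dW i * m.step (l + 1))) * m.U l := by
      simp only [mul_assoc]
    rw [h4, ← h3.eq, ← mul_assoc (star (m.step (l + 1))), h2, one_mul]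

/-- The observation algebra as an algebra of functions. -/
def IsUnitary.obs (hm : m.IsUnitary) {l : ℕ} (hl : l ≤ N) :
    ((Fin l → Fin 2) → ℂ) →⋆ₐ[ℂ] TotOp κ N :=
  StarAlgHom.comp
    ((Unitary.conjStarAlgAut ℂ (TotOp κ N) (star (⟨m.U l, hm.U_mem hl⟩ : unitary (TotOp κ N))) :
      TotOp κ N ≃⋆ₐ[ℂ] TotOp κ N) : TotOp κ N →⋆ₐ[ℂ] TotOp κ N) (cyl hl)

lemma IsUnitary.obs_apply (hm : m.IsUnitary) {l : ℕ} (hl : l ≤ N) (c : (Fin l → Fin 2) → ℂ) :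
    hm.obs hl c = star (m.U l) * cyl hl c * m.U l := by
  change star (m.U l) * cyl hl c * star (star (m.U l)) = _
  rw [star_star]

lemma IsUnitary.conj_mem_obsAlg (hm : m.IsUnitary) {l : ℕ} (hl : l ≤ N) {A : TotOp κ N}
    (hA : A ∈ m.fieldAlg l) :
    star (m.U l) * A * m.U l ∈ m.obsAlg l := by
  let φ : TotOp κ N →⋆ₐ[ℂ] TotOp κ N :=
    ((Unitary.conjStarAlgAut ℂ (TotOp κ N) (star (⟨m.U l, hm.U_mem hl⟩ : unitary (TotOp κ N))) :
      TotOp κ N ≃⋆ₐ[ℂ] TotOp κ N) : TotOp κ N →⋆ₐ[ℂ] TotOp κ N)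
  have hφ : ∀ A, φ A = star (m.U l) * A * m.U l := fun A => by
    change star (m.U l) * A * star (star (m.U l)) = _
    rw [star_star]
  have h : m.fieldAlg l ≤ (m.obsAlg l).comap φ := by
    refine StarAlgebra.adjoin_le ?_
    rintro _ ⟨i, h1, h2, rfl⟩
    change φ _ ∈ m.obsAlg l
    rw [hφ, ← hm.dY_eq h2 hl]
    exact StarAlgebra.subset_adjoin _ _ ⟨i, h1, h2, rfl⟩
  have := h hA
  change φ _ ∈ m.obsAlg l at this
  rwa [hφ] at this

lemma IsUnitary.mem_obsAlg (hm : m.IsUnitary) {l : ℕ} (hl : l ≤ N) (A : TotOp κ N) :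
    A ∈ m.obsAlg l ↔ ∃ c, hm.obs hl c = A := by
  constructor
  · intro h
    have h1 : m.obsAlg l ≤ (hm.obs hl).range := by
      refine StarAlgebra.adjoin_le ?_
      rintro _ ⟨i, h1, h2, rfl⟩
      have h3 : m.dW i ∈ m.fieldAlg l := StarAlgebra.subset_adjoin _ _ ⟨i, h1, h2, rfl⟩
      obtain ⟨c, hc⟩ := (m.mem_fieldAlg hl _).1 h3
      exact ⟨c, by rw [hm.dY_eq h2 hl, ← hc]; exact hm.obs_apply hl c⟩
    exact h1 h
  · rintro ⟨c, rfl⟩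
    rw [hm.obs_apply]
    exact hm.conj_mem_obsAlg hl ((m.mem_fieldAlg hl _).2 ⟨c, rfl⟩)

lemma IsUnitary.check_eq (hm : m.IsUnitary) {u : ∀ i, m.obsAlg i} {l : ℕ} (hl : l ≤ N) {c :
    (Fin l → Fin 2) → ℂ}
    (hc : hm.obs hl c = u l) : m.check u l = cyl hl c := by
  rw [check, ← hc, hm.obs_apply, mul_assoc (star (m.U l)), ← mul_assoc (m.U l),
    hm.U_mul_star_U hl, one_mul, mul_assoc, hm.U_mul_star_U hl, mul_one]

lemma IsUnitary.check_mem (hm : m.IsUnitary) (u : ∀ i, m.obsAlg i) {l : ℕ} (hl : l ≤ N) :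
    m.check u l ∈ m.fieldAlg l := by
  obtain ⟨c, hc⟩ := (hm.mem_obsAlg hl _).1 (u l).2
  rw [hm.check_eq hl hc]
  exact (m.mem_fieldAlg hl _).2 ⟨c, rfl⟩

lemma IsUnitary.riskFactor_commute (hm : m.IsUnitary) (X : Matrix (Fin 2) (Fin 2) ℂ) (μ₁ : ℝ)
    (u : ∀ i, m.obsAlg i)
    {l : ℕ} (hl : l ≤ N) {B : TotOp κ N} (h : ∀ Y, Commute (embSys Y) B)
    (h' : ∀ i, 1 ≤ i → i ≤ l → Commute (m.dW i) B) : Commute (m.riskFactor X μ₁ u l) B := by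
  rw [riskFactor]
  split_ifs
  · exact Commute.one_left _
  · refine Commute.exp_left (Commute.smul_left ?_ _)
    rw [absSq, star_sub, star_embSys]
    exact ((h _).sub_left (m.fieldAlg_commute h' (star_mem (hm.check_mem u hl)))).mul_left
      ((h _).sub_left (m.fieldAlg_commute h' (hm.check_mem u hl)))

/-- The term λ⁻²(E - I)Δt equals E - I because Δt = λ²I. It turns the initial I into E, after which
E factors out on the right, as it commutes with ΔW(l+1). -/
lemma IsUnitary.Vmu_succ (hm : m.IsUnitary) (X : Matrix (Fin 2) (Fin 2) ℂ) (μ₁ : ℝ)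
    (u : ∀ i, m.obsAlg i)
    {l : ℕ} (hl : l ≤ N) :
    m.Vmu X μ₁ u (l + 1) = m.vstep (l + 1) * (m.riskFactor X μ₁ u l * m.Vmu X μ₁ u l) := by
  have h1 : Commute (m.riskFactor X μ₁ u l) (m.dW (l + 1)) :=
    hm.riskFactor_commute X μ₁ u hl (fun Y => m.embSys_commute_dW Y _)
      fun i _ _ => m.dW_commute_dW _ _
  have h2 : ((m.lam : ℂ) ^ 2) ≠ 0 := pow_ne_zero _ (by exact_mod_cast m.lam_pos.ne')
  rw [Vmu, vstep, dt_eq, mul_assoc (embSys (compose m.Mplus m.p)), h1.eq]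
  generalize m.Vmu X μ₁ u l = v
  generalize m.riskFactor X μ₁ u l = E
  simp only [mul_smul_comm, mul_one, smul_add, smul_sub, add_mul, one_mul, sub_mul, smul_mul_assoc,
    smul_smul, mul_inv_cancel₀ h2, one_smul, mul_assoc]
  abel

/-- Used for two kinds of B: operators on a later slice, which gives adaptedness, and elements of
𝒞_l, which makes conditioning possible. -/
lemma IsUnitary.Vmu_commute (hm : m.IsUnitary) (X : Matrix (Fin 2) (Fin 2) ℂ) (μ₁ : ℝ)
    (u : ∀ i, m.obsAlg i)
    {l : ℕ} (hl : l ≤ N) {B : TotOp κ N} (h : ∀ Y, Commute (embSys Y) B)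
    (h' : ∀ i, 1 ≤ i → i ≤ l → Commute (m.dW i) B) : Commute (m.Vmu X μ₁ u l) B := by
  induction l with
  | zero => exact Commute.one_left _
  | succ l ih =>
    have h2 : ∀ i, 1 ≤ i → i ≤ l → Commute (m.dW i) B := fun i h1 h2 => h' i h1 (by omega)
    rw [hm.Vmu_succ X μ₁ u (by omega)]
    exact (m.vstep_commute h (h' _ (by omega) le_rfl)).mul_left
      ((hm.riskFactor_commute X μ₁ u (by omega) h h2).mul_left (ih (by omega) h2))

lemma IsUnitary.errorOp_eq (hm : m.IsUnitary) (X : Matrix (Fin 2) (Fin 2) ℂ)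
    (u : ∀ i, m.obsAlg i) {l : ℕ}
    (hl : l ≤ N) :
    m.errorOp X u l = star (m.U l) * absSq (embSys (atomOp X) - m.check u l) * m.U l := by
  have h : m.flow l (embSys (atomOp X)) - (u l : TotOp κ N)
      = star (m.U l) * (embSys (atomOp X) - m.check u l) * m.U l := by
    rw [flow, check, mul_sub, sub_mul]
    congr 1
    rw [← mul_assoc, ← mul_assoc, hm.star_U_mul_U hl, one_mul, mul_assoc, hm.star_U_mul_U hl,
      mul_one]
  rw [errorOp, h, absSq, absSq]
  generalize embSys (atomOp X) - m.check u l = B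
  simp only [star_mul, star_star, mul_assoc]
  rw [← mul_assoc (m.U l) (star (m.U l)), hm.U_mul_star_U hl, one_mul]

lemma IsUnitary.exp_conj (hm : m.IsUnitary) {l : ℕ} (hl : l ≤ N) (c : ℂ) (B : TotOp κ N) :
    NormedSpace.exp (c • (star (m.U l) * B * m.U l))
      = star (m.U l) * NormedSpace.exp (c • B) * m.U l := by
  have h1 : (m.U l)⁻¹ = star (m.U l) := Matrix.inv_eq_left_inv (hm.star_U_mul_U hl)
  have h2 : IsUnit (m.U l) := (Matrix.isUnit_iff_isUnit_det _).2
    (Matrix.isUnit_det_of_left_inverse (hm.star_U_mul_U hl))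
  rw [← h1, ← Matrix.exp_conj' _ _ h2, mul_smul_comm, smul_mul_assoc]

/-- Moving U(l) to the right past the newest factor of R(l+1) turns the exponential of the error in
the Heisenberg picture into E_l, which is the factor in the recursion of V^μ. -/
lemma IsUnitary.U_mul_R_mul_vac (hm : m.IsUnitary) (X : Matrix (Fin 2) (Fin 2) ℂ) (μ₁ : ℝ)
    (u : ∀ i, m.obsAlg i)
    {l : ℕ} (hl : l ≤ N) :
    m.U l * m.R X μ₁ u l * vac κ N = m.Vmu X μ₁ u l * vac κ N := by
  induction l with
  | zero => rw [U, R, Vmu, one_mul]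
  | succ l ih =>
    -- At l = 0 this holds because R(1) = I matches E_0 = I.
    have h1 : m.U l * m.R X μ₁ u (l + 1) = m.riskFactor X μ₁ u l * (m.U l * m.R X μ₁ u l) := by
      rcases l with _ | l
      · simp [R, riskFactor]
      · rw [R, riskFactor, if_neg (by omega), hm.errorOp_eq X u (by omega),
          hm.exp_conj (by omega), mul_assoc (star _ * _), ← mul_assoc (m.U (l + 1)),
          ← mul_assoc (m.U (l + 1)), hm.U_mul_star_U (by omega), one_mul]
    have h2 : ∀ Y, Commute (m.riskFactor X μ₁ u l * m.Vmu X μ₁ u l)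
        (embField (slice N (l + 1) Y)) := fun Y =>
      (hm.riskFactor_commute X μ₁ u (by omega) (fun Z => embSys_commute _ _)
        fun i _ hi => m.dW_commute_slice (by omega) _).mul_left
      (hm.Vmu_commute X μ₁ u (by omega) (fun Z => embSys_commute _ _)
        fun i _ hi => m.dW_commute_slice (by omega) _)
    rw [hm.Vmu_succ X μ₁ u (by omega), U, mul_assoc (m.step _), h1, mul_assoc (m.step _),
      mul_assoc (m.riskFactor X μ₁ u l), ih (by omega), ← mul_assoc (m.riskFactor X μ₁ u l),
      m.step_mul_vac (by omega) hl h2, mul_assoc (m.vstep (l + 1))]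

lemma errorOp_congr {X : Matrix (Fin 2) (Fin 2) ℂ} {u u' : ∀ i, m.obsAlg i} {l : ℕ}
    (h : u l = u' l) : m.errorOp X u l = m.errorOp X u' l := by
  rw [errorOp, errorOp, h]

lemma R_congr {X : Matrix (Fin 2) (Fin 2) ℂ} {μ₁ : ℝ} {u u' : ∀ i, m.obsAlg i} {l : ℕ}
    (h : ∀ i, i < l → u i = u' i) : m.R X μ₁ u l = m.R X μ₁ u' l := by
  induction l with
  | zero => rfl
  | succ l ih =>
    rcases l with _ | l
    · rfl
    · rw [R, R, ih fun i hi => h i (by omega), errorOp_congr (h (l + 1) (by omega))]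

lemma cost_congr {ρ : SysOp κ} {X : Matrix (Fin 2) (Fin 2) ℂ} {μ₁ μ₂ : ℝ}
    {u u' : ∀ i, m.obsAlg i} {l : ℕ} (h : ∀ i, i ≤ l → u i = u' i) :
    m.cost ρ X μ₁ μ₂ u l = m.cost ρ X μ₁ μ₂ u' l := by
  rw [cost, cost, R_congr fun i hi => h i hi.le, errorOp_congr (h l le_rfl)]

/-- Causality with strict inequality: the filter at time l is unaffected by the choice of 𝔲_l, so it
stays fixed while the cost is minimized over 𝔲_l. -/
lemma Vmu_congr {X : Matrix (Fin 2) (Fin 2) ℂ} {μ₁ : ℝ} {u u' : ∀ i, m.obsAlg i} {l : ℕ}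
    (h : ∀ i, i < l → u i = u' i) : m.Vmu X μ₁ u l = m.Vmu X μ₁ u' l := by
  induction l with
  | zero => rfl
  | succ l ih =>
    have h1 : m.riskFactor X μ₁ u l = m.riskFactor X μ₁ u' l := by
      rw [riskFactor, riskFactor, check, check, h l (by omega)]
    rw [Vmu, Vmu, ih fun i hi => h i (by omega), h1]

end Model

end Dynamics

end RiskSensitive

end

noncomputable section

set_option linter.unusedSectionVars false

namespace RiskSensitive

/-! ### Filters as positive matrices indexed by sign configurations. -/

section Filters

open scoped ComplexOrder

variable {κ : Type*} [Fintype κ] [DecidableEq κ] {N : ℕ}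

/-! ### Block diagonal density matrices -/

/-- The partial trace over the field. -/
def ptrace (M : TotOp κ N) : SysOp κ := ∑ f, M.submatrix (fun x => (x, f)) (fun x => (x, f))

lemma trace_ptrace_mul (M : TotOp κ N) (X : SysOp κ) :
    (ptrace M * X).trace = (M * embSys X).trace := by
  simp only [ptrace, Matrix.trace, Matrix.diag, Matrix.mul_apply, Matrix.sum_apply,
    Matrix.submatrix_apply, embSys, Matrix.kroneckerMap_apply,
    Fintype.sum_prod_type (α₁ := κ × Fin 2),
    Matrix.one_apply, mul_ite, mul_one, mul_zero, Finset.sum_ite_eq', Finset.mem_univ, if_true,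
    Finset.sum_mul]
  exact Finset.sum_congr rfl fun x _ => Finset.sum_comm

lemma ptrace_posSemidef {M : TotOp κ N} (hM : M.PosSemidef) : (ptrace M).PosSemidef :=
  Matrix.posSemidef_sum _ fun _ _ => hM.submatrix _

/-- The block diagonal part. -/
def blockPart (D : SysOp κ) : SysOp κ :=
  Matrix.of fun x y => if x.1 = y.1 then D x y else 0

lemma blockPart_mem (D : SysOp κ) : blockPart D ∈ paramSysAlg κ := by
  intro a b i j h
  simp [blockPart, h]

lemma trace_blockPart_mul (D : SysOp κ) {X : SysOp κ} (hX : X ∈ paramSysAlg κ) :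
    (blockPart D * X).trace = (D * X).trace := by
  simp only [Matrix.trace, Matrix.diag, Matrix.mul_apply]
  refine Finset.sum_congr rfl fun x _ => Finset.sum_congr rfl fun y _ => ?_
  by_cases h : x.1 = y.1
  · simp [blockPart, h]
  · rw [hX y.1 x.1 y.2 x.2 (Ne.symm h)]
    simp

lemma blockPart_posSemidef {D : SysOp κ} (hD : D.PosSemidef) : (blockPart D).PosSemidef := by
  have h : blockPart D = ∑ a : κ,
      Matrix.diagonal (fun x : κ × Fin 2 => if x.1 = a then (1 : ℂ) else 0) * D *
        (Matrix.diagonal (fun x : κ × Fin 2 => if x.1 = a then (1 : ℂ) else 0)).conjTranspose := by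
    ext x y
    rw [Matrix.sum_apply]
    simp only [Matrix.diagonal_conjTranspose, Matrix.mul_diagonal, Matrix.diagonal_mul, blockPart,
      Matrix.of_apply, Pi.star_apply, apply_ite star, star_one, star_zero, ite_mul, one_mul,
      zero_mul, mul_ite, mul_one, mul_zero]
    by_cases h : x.1 = y.1
    · simp [h]
    · rw [if_neg h]
      refine (Finset.sum_eq_zero fun a _ => ?_).symm
      split_ifs with h1 h2
      · exact absurd (h2.trans h1.symm) h
      all_goals rfl
  rw [h]
  exact Matrix.posSemidef_sum _ fun a _ => hD.mul_mul_conjTranspose_same _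

/-- The matrix units within a block belong to 𝒫 ⊗ ℳ and read off every entry that need not vanish.
-/
lemma paramSysAlg_ext {D D' : SysOp κ} (hD : D ∈ paramSysAlg κ) (hD' : D' ∈ paramSysAlg κ)
    (h : ∀ X ∈ paramSysAlg κ, (D * X).trace = (D' * X).trace) : D = D' := by
  have key : ∀ (E : SysOp κ) x y, (E * Matrix.single y x 1).trace = E x y := fun E x y => by
    rw [Matrix.trace_mul_comm, Matrix.trace_single_mul]
    simp
  ext ⟨a, i⟩ ⟨b, j⟩
  by_cases hab : a = b
  · subst hab
    rw [← key D, ← key D']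
    refine h _ fun a' b' i' j' hne => ?_
    rw [Matrix.single_apply, if_neg]
    rintro ⟨h1, h2⟩
    simp only [Prod.mk.injEq] at h1 h2
    exact hne (h1.1.symm.trans h2.1)
  · rw [hD a b i j hab, hD' a b i j hab]

/-- Commutation with the projections of the parameter space is inherited by exponentials, for which
the entrywise condition would be awkward to check. -/
lemma mem_paramSysAlg_of_commute {X : SysOp κ}
    (h : ∀ a : κ, Commute X (Matrix.single a a (1 : ℂ) ⊗ₖ (1 : Matrix (Fin 2) (Fin 2) ℂ))) :
    X ∈ paramSysAlg κ := by
  intro a b i j hab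
  have h1 := congrFun (congrFun (h a).eq (a, i)) (b, j)
  rw [Matrix.mul_apply, Matrix.mul_apply] at h1
  simp only [Matrix.kroneckerMap_apply, Fintype.sum_prod_type, Matrix.single_apply,
    Matrix.one_apply] at h1
  rw [Finset.sum_eq_zero, Finset.sum_eq_single a, Finset.sum_eq_single i] at h1
  · simpa using h1.symm
  · intro k _ hk
    simp [hk.symm]
  · simp
  · intro c _ hc
    simp [hc.symm]
  · simp
  · intro c _
    simp [hab]

/-- The error `|X - z|²` of a constant estimate. -/
def constErr (X : Matrix (Fin 2) (Fin 2) ℂ) (z : ℂ) : SysOp κ :=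
  absSq (atomOp X - z • (1 : SysOp κ))

lemma constErr_commute (X : Matrix (Fin 2) (Fin 2) ℂ) (z : ℂ) (a : κ) :
    Commute (constErr X z) (Matrix.single a a (1 : ℂ) ⊗ₖ (1 : Matrix (Fin 2) (Fin 2) ℂ)) := by
  have h : ∀ Y, Commute (atomOp Y) (Matrix.single a a (1 : ℂ) ⊗ₖ (1 : Matrix (Fin 2) (Fin 2) ℂ)) :=
    fun Y => by simp [Commute, SemiconjBy, atomOp, ← Matrix.mul_kronecker_mul]
  have h1 : star (atomOp X : SysOp κ) = atomOp (star X) := by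
    simp [atomOp, Matrix.star_eq_conjTranspose, Matrix.conjTranspose_kronecker]
  rw [constErr, absSq, star_sub, h1, star_smul, star_one]
  exact ((h _).sub_left ((Commute.one_left _).smul_left _)).mul_left
    ((h _).sub_left ((Commute.one_left _).smul_left _))

lemma constErr_mem (X : Matrix (Fin 2) (Fin 2) ℂ) (z : ℂ) : constErr X z ∈ paramSysAlg κ :=
  mem_paramSysAlg_of_commute (constErr_commute X z)

lemma exp_constErr_mem (X : Matrix (Fin 2) (Fin 2) ℂ) (c z : ℂ) :
    NormedSpace.exp (c • constErr X z) ∈ paramSysAlg κ :=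
  mem_paramSysAlg_of_commute fun a => Commute.exp_left ((constErr_commute X z a).smul_left c)

lemma one_mem_paramSysAlg : (1 : SysOp κ) ∈ paramSysAlg κ :=
  mem_paramSysAlg_of_commute fun _ => Commute.one_left _

lemma prodDensity_isDensity {r : κ → ℝ} (hr : r ∈ stdSimplex ℝ κ)
    {ρ : Matrix (Fin 2) (Fin 2) ℂ} (hρ : IsDensity ρ) : IsDensity (prodDensity r ρ) := by
  refine ⟨Matrix.PosSemidef.kronecker (Matrix.PosSemidef.diagonal fun a => ?_) hρ.1, ?_⟩
  · have := hr.1 a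
    simpa using this
  · rw [prodDensity, Matrix.trace_kronecker, hρ.2, mul_one, Matrix.trace_diagonal]
    exact_mod_cast hr.2

lemma vacuumProj_posSemidef : (vacuumProj N).PosSemidef :=
  Matrix.posSemidef_vecMulVec_self_star _

/-! ### Functions on the first slices -/

variable {l : ℕ}

lemma star_cyl_single (hl : l ≤ N) (s : Fin l → Fin 2) :
    star (cyl hl (Pi.single s 1) : TotOp κ N) = cyl hl (Pi.single s 1) := by
  rw [← map_star]
  congr 1
  ext s'
  by_cases h : s' = s
  · subst h; simp
  · simp [h]

lemma cyl_single_mul_self (hl : l ≤ N) (s : Fin l → Fin 2) :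
    (cyl hl (Pi.single s 1) * cyl hl (Pi.single s 1) : TotOp κ N) = cyl hl (Pi.single s 1) := by
  rw [← map_mul]
  congr 1
  ext s'
  by_cases h : s' = s
  · subst h; simp
  · simp [h]

lemma sum_cyl_single (hl : l ≤ N) :
    ∑ s, (cyl hl (Pi.single s 1) : TotOp κ N) = 1 := by
  rw [← map_sum, ← map_one (cyl hl)]
  congr 1
  ext s
  simp [Finset.sum_apply, Pi.single_apply]

lemma cylBlock_commute_cyl (hl : l ≤ N) (f : (Fin l → Fin 2) → SysOp κ)
    (c : (Fin l → Fin 2) → ℂ) : Commute (cylBlock hl f) (cyl hl c : TotOp κ N) := by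
  rw [Commute, SemiconjBy, cyl_eq_cylBlock, ← map_mul, ← map_mul]
  congr 1
  ext1 s
  simp

lemma embSys_commute_cyl (hl : l ≤ N) (X : SysOp κ) (c : (Fin l → Fin 2) → ℂ) :
    Commute (embSys X) (cyl hl c : TotOp κ N) := by
  rw [embSys_eq_cylBlock hl]
  exact cylBlock_commute_cyl hl _ c

lemma absSq_sub_cyl (hl : l ≤ N) (X : Matrix (Fin 2) (Fin 2) ℂ) (c : (Fin l → Fin 2) → ℂ) :
    absSq (embSys (atomOp X) - cyl hl c : TotOp κ N) = cylBlock hl (fun s => constErr X (c s)) := by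
  rw [embSys_eq_cylBlock hl, cyl_eq_cylBlock, absSq, ← map_sub, ← map_star, ← map_mul]
  rfl

/-- `cylBlock` is an algebra homomorphism in finite dimension, hence continuous, and the exponential
in a finite product is taken componentwise. The norms introduced below serve only to state
continuity. -/
lemma exp_cylBlock (hl : l ≤ N) (f : (Fin l → Fin 2) → SysOp κ) :
    NormedSpace.exp (cylBlock hl f : TotOp κ N) = cylBlock hl (fun s => NormedSpace.exp (f s)) := by
  let _ : NormedRing (SysOp κ) := Matrix.linftyOpNormedRing
  let _ : NormedAlgebra ℂ (SysOp κ) := Matrix.linftyOpNormedAlgebra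
  let _ : NormedRing (TotOp κ N) := Matrix.linftyOpNormedRing
  let _ : NormedAlgebra ℂ (TotOp κ N) := Matrix.linftyOpNormedAlgebra
  let _ : NormedAlgebra ℚ (SysOp κ) := NormedAlgebra.restrictScalars ℚ ℂ _
  let _ : NormedAlgebra ℚ (TotOp κ N) := NormedAlgebra.restrictScalars ℚ ℂ _
  have : CompleteSpace (SysOp κ) := FiniteDimensional.complete ℂ _
  have hc : Continuous (cylBlock hl : ((Fin l → Fin 2) → SysOp κ) →⋆ₐ[ℂ] TotOp κ N) :=
    LinearMap.continuous_of_finiteDimensional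
      ((cylBlock hl : ((Fin l → Fin 2) → SysOp κ) →⋆ₐ[ℂ] TotOp κ N).toAlgHom.toLinearMap)
  refine (NormedSpace.map_exp (cylBlock hl) hc f).symm.trans ?_
  congr 1
  ext1 s
  exact NormedSpace.map_exp (Pi.evalRingHom (fun _ : Fin l → Fin 2 => SysOp κ) s)
    (continuous_apply s) f

/-! ### The information density -/

/-- The unnormalized information density matrix on the event `s`. -/
def infoDensity (hl : l ≤ N) (ρ : SysOp κ) (v : TotOp κ N) (s : Fin l → Fin 2) : SysOp κ :=
  ((cylWeight hl s)⁻¹ : ℝ) • blockPart (ptrace (v * cyl hl (Pi.single s 1) * (ρ ⊗ₖ vacuumProj N) *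
    (v * cyl hl (Pi.single s 1)).conjTranspose))

lemma infoDensity_mem (hl : l ≤ N) (ρ : SysOp κ) (v : TotOp κ N) (s : Fin l → Fin 2) :
    infoDensity hl ρ v s ∈ paramSysAlg κ := by
  intro a b i j hab
  rw [infoDensity, Matrix.smul_apply, blockPart_mem _ a b i j hab, smul_zero]

/-- Congruence, partial trace and restriction to blocks all preserve positivity; the two-sided form
of `infoDensity` is chosen for this. -/
lemma infoDensity_posSemidef (hl : l ≤ N) {ρ : SysOp κ} (hρ : ρ.PosSemidef) (v : TotOp κ N)
    (s : Fin l → Fin 2) : (infoDensity hl ρ v s).PosSemidef :=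
  (blockPart_posSemidef (ptrace_posSemidef
    ((hρ.kronecker vacuumProj_posSemidef).mul_mul_conjTranspose_same _))).smul
    (inv_nonneg.2 (cylWeight_pos hl s).le)

lemma commute_star_mul_mul (hl : l ≤ N) {v : TotOp κ N} (hv : ∀ c, Commute v (cyl hl c))
    (X : SysOp κ) (c : (Fin l → Fin 2) → ℂ) : Commute (star v * embSys X * v) (cyl hl c) := by
  have h1 : Commute (star v) (cyl hl c) := by
    have h := congrArg star (hv (star c)).eq
    rw [star_mul, star_mul, ← map_star, star_star] at h
    exact h.symm
  exact (h1.mul_left (embSys_commute_cyl hl X c)).mul_left (hv c)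

lemma trace_infoDensity_mul (hl : l ≤ N) (ρ : SysOp κ) {v : TotOp κ N}
    (hv : ∀ c, Commute v (cyl hl c)) (s : Fin l → Fin 2) {X : SysOp κ} (hX : X ∈ paramSysAlg κ) :
    (cylWeight hl s : ℂ) * (infoDensity hl ρ v s * X).trace
      = stateLin ρ (star v * embSys X * v * cyl hl (Pi.single s 1)) := by
  have h0 : (cylWeight hl s : ℂ) ≠ 0 := by exact_mod_cast (cylWeight_pos hl s).ne'
  rw [infoDensity, Matrix.smul_mul, Matrix.trace_smul, trace_blockPart_mul _ hX, trace_ptrace_mul,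
    Complex.real_smul]
  push_cast
  rw [← mul_assoc, mul_inv_cancel₀ h0, one_mul]
  have h2 := (commute_star_mul_mul hl hv X (Pi.single s 1)).eq
  change _ = (star v * embSys X * v * cyl hl (Pi.single s 1) * (ρ ⊗ₖ vacuumProj N)).trace
  -- A projection commuting with v*Xv may be placed on both sides, which matches the symmetric form
  -- of `infoDensity`.
  have h3 : star v * embSys X * v * cyl hl (Pi.single s 1)
      = cyl hl (Pi.single s 1) * (star v * embSys X * v) * cyl hl (Pi.single s 1) := by
    rw [← h2, mul_assoc _ (cyl hl (Pi.single s 1)), cyl_single_mul_self]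
  rw [h3, ← Matrix.star_eq_conjTranspose, star_mul, star_cyl_single, mul_assoc,
    Matrix.trace_mul_comm]
  simp only [mul_assoc]

/-- The point indicators sum to 1, so χ is nonzero on one of them, and cδ_s = c(s)δ_s then
determines χ. Evaluation at a point of Ω is such a character of 𝒴_l, which links Ω to the
configurations. -/
lemma exists_eq_eval {S : Type*} [Fintype S] [DecidableEq S] (χ : (S → ℂ) →ₐ[ℂ] ℂ) :
    ∃ s, ∀ c, χ c = c s := by
  have h1 : ∑ s, χ (Pi.single s 1) = 1 := by
    rw [← map_sum, ← map_one χ]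
    congr 1
    ext s
    simp [Finset.sum_apply, Pi.single_apply]
  obtain ⟨s, -, hs⟩ := Finset.exists_ne_zero_of_sum_ne_zero (h1.trans_ne one_ne_zero)
  refine ⟨s, fun c => mul_right_cancel₀ hs ?_⟩
  rw [← map_mul, ← smul_eq_mul (c s), ← map_smul]
  congr 1
  ext s'
  by_cases h : s' = s
  · subst h; simp
  · simp [h]

namespace Model

variable {m : Model κ N}

/-- Every point of `Ω` determines the signs of the first `l` observations. -/
lemma IsUnitary.exists_point (hm : m.IsUnitary) (hl : l ≤ N) {Ω : Type*} [MeasurableSpace Ω]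
    (ι : SpectralIso (m.obsAlg l) Ω) :
    ∃ pt : Ω → Fin l → Fin 2, ∀ (ω : Ω) (A : m.obsAlg l) (c : (Fin l → Fin 2) → ℂ),
      hm.obs hl c = A → ι.toHom A ω = c (pt ω) := by
  have h : ∀ ω : Ω, ∃ s, ∀ (A : m.obsAlg l) (c : (Fin l → Fin 2) → ℂ),
      hm.obs hl c = A → ι.toHom A ω = c s := fun ω => by
    let χ : ((Fin l → Fin 2) → ℂ) →ₐ[ℂ] ℂ := (Pi.evalAlgHom ℂ (fun _ : Ω => ℂ) ω).comp
      ((ι.toHom : m.obsAlg l →ₐ[ℂ] (Ω → ℂ)).comp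
        ((StarAlgHom.codRestrict (hm.obs hl) (m.obsAlg l)
          fun c => (hm.mem_obsAlg hl _).2 ⟨c, rfl⟩ :
            ((Fin l → Fin 2) → ℂ) →⋆ₐ[ℂ] m.obsAlg l) : ((Fin l → Fin 2) → ℂ) →ₐ[ℂ] m.obsAlg l))
    obtain ⟨s, hs⟩ := exists_eq_eval χ
    refine ⟨s, fun A c hc => ?_⟩
    rw [← hs c]
    obtain ⟨A, hA⟩ := A
    simp only at hc
    subst hc
    rfl
  choose pt hpt using h
  exact ⟨pt, hpt⟩

lemma cyl_commute (m : Model κ N) (hl : l ≤ N) {B : TotOp κ N}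
    (h : ∀ i, 1 ≤ i → i ≤ l → Commute (m.dW i) B) (c : (Fin l → Fin 2) → ℂ) :
    Commute (cyl hl c) B :=
  m.fieldAlg_commute h ((m.mem_fieldAlg hl _).2 ⟨c, rfl⟩)

lemma V_commute_cyl (m : Model κ N) (hl : l ≤ N) (c : (Fin l → Fin 2) → ℂ) : Commute (m.V l)
    (cyl hl c) :=
  (m.V_commute (fun Y => embSys_commute_cyl hl Y c) fun _ _ _ =>
    (m.cyl_commute hl (fun _ _ _ => m.dW_commute_dW _ _) c).symm)

lemma IsUnitary.Vmu_commute_cyl (hm : m.IsUnitary) (X : Matrix (Fin 2) (Fin 2) ℂ) (μ₁ : ℝ)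
    (u : ∀ i, m.obsAlg i) (hl : l ≤ N) (c : (Fin l → Fin 2) → ℂ) :
    Commute (m.Vmu X μ₁ u l) (cyl hl c) :=
  (hm.Vmu_commute X μ₁ u hl (fun Y => embSys_commute_cyl hl Y c) fun _ _ _ =>
    (m.cyl_commute hl (fun _ _ _ => m.dW_commute_dW _ _) c).symm)

/-- Testing against the minimal projections of 𝒞_l and cancelling their positive weights leaves
exactly one conditional expectation; the trace pairing on 𝒫 ⊗ ℳ then determines ϱ at every point. -/
lemma IsUnitary.isInfoDensity_iff (hm : m.IsUnitary) (hl : l ≤ N) {Ω : Type*} [MeasurableSpace Ω]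
    (ι : SpectralIso (m.obsAlg l) Ω) {ρ : SysOp κ} (hρ : ρ.trace = 1) {v : TotOp κ N}
    (hv : ∀ c, Commute v (cyl hl c)) {pt : Ω → Fin l → Fin 2}
    (hpt : ∀ (ω : Ω) (A : m.obsAlg l) (c : (Fin l → Fin 2) → ℂ),
      hm.obs hl c = A → ι.toHom A ω = c (pt ω)) (ϱ : Ω → SysOp κ) :
    m.IsInfoDensity ρ v l ι ϱ ↔ ϱ = fun ω => infoDensity hl ρ v (pt ω) := by
  have hce : ∀ (X : SysOp κ) (hX : X ∈ paramSysAlg κ) (c : (Fin l → Fin 2) → ℂ) (E : m.fieldAlg l),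
      cyl hl c = (E : TotOp κ N) →
      (IsCondExp (stateOf ρ) (m.fieldAlg l) (star v * embSys X * v) E ↔
        ∀ s, c s = (infoDensity hl ρ v s * X).trace) := by
    intro X hX c E hE
    have h1 := isCondExp_iff (stateLin ρ) (cyl hl) (fun A => m.mem_fieldAlg hl A)
      (star v * embSys X * v) c E hE
    have h2 : IsCondExp (stateOf ρ) (m.fieldAlg l) (star v * embSys X * v) E ↔
        IsCondExp (stateLin ρ) (m.fieldAlg l) (star v * embSys X * v) E := Iff.rfl
    rw [h2, h1, and_iff_right fun d => commute_star_mul_mul hl hv X d]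
    refine forall_congr' fun s => ?_
    have h0 : (cylWeight hl s : ℂ) ≠ 0 := by exact_mod_cast (cylWeight_pos hl s).ne'
    rw [← trace_infoDensity_mul hl ρ hv s hX, stateLin_cyl_single hl hρ, mul_comm]
    exact mul_right_inj' h0
  constructor
  · rintro ⟨h1, h2⟩
    ext1 ω
    refine paramSysAlg_ext (h1 ω) (infoDensity_mem hl ρ v _) fun X hX => ?_
    obtain ⟨E, σ, hE, hσ, hω⟩ := h2 X hX
    obtain ⟨c, hc⟩ := (m.mem_fieldAlg hl _).1 E.2
    rw [← hω ω, hpt ω σ c (by rw [hm.obs_apply, hc, hσ])]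
    exact (hce X hX c E hc).1 hE _
  · rintro rfl
    refine ⟨fun ω => infoDensity_mem hl ρ v _, fun X hX => ?_⟩
    let c : (Fin l → Fin 2) → ℂ := fun s => (infoDensity hl ρ v s * X).trace
    refine ⟨⟨cyl hl c, (m.mem_fieldAlg hl _).2 ⟨c, rfl⟩⟩,
      ⟨hm.obs hl c, (hm.mem_obsAlg hl _).2 ⟨c, rfl⟩⟩, (hce X hX c _ rfl).2 fun s => rfl,
      hm.obs_apply hl c, fun ω => hpt ω _ c rfl⟩

/-- The cost decouples over configurations: since V^μ(l) does not involve 𝔲_l, this estimate enters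
the summand of s only through the number c s. Global and pointwise minimization therefore coincide.
-/
lemma IsUnitary.cost_eq (hm : m.IsUnitary) (hl : l ≤ N) (ρ : SysOp κ)
    (X : Matrix (Fin 2) (Fin 2) ℂ) (μ₁ μ₂ : ℝ) (u : ∀ i, m.obsAlg i)
    {c : (Fin l → Fin 2) → ℂ} (hc : hm.obs hl c = u l) :
    m.cost ρ X μ₁ μ₂ u l = ∑ s, cylWeight hl s *
      (infoDensity hl ρ (m.Vmu X μ₁ u l) s *
        NormedSpace.exp ((μ₂ : ℂ) • constErr X (c s))).trace.re := by
  have hv := hm.Vmu_commute_cyl X μ₁ u hl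
  have h1 : stateOf ρ (star (m.R X μ₁ u l) * NormedSpace.exp ((μ₂ : ℂ) • m.errorOp X u l)
      * m.R X μ₁ u l) = stateLin ρ (star (m.Vmu X μ₁ u l) *
        cylBlock hl (fun s => NormedSpace.exp ((μ₂ : ℂ) • constErr X (c s))) *
          m.Vmu X μ₁ u l) := by
    have h2 : NormedSpace.exp ((μ₂ : ℂ) • m.errorOp X u l) = star (m.U l) *
        cylBlock hl (fun s => NormedSpace.exp ((μ₂ : ℂ) • constErr X (c s))) * m.U l := by
      rw [hm.errorOp_eq X u hl, hm.exp_conj hl, hm.check_eq hl hc, absSq_sub_cyl, ← map_smul,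
        exp_cylBlock]
      rfl
    refine Eq.trans ?_ (stateOf_conj_congr ρ (hm.U_mul_R_mul_vac X μ₁ u hl) _)
    rw [h2, star_mul]
    simp only [mul_assoc]
  rw [cost, h1]
  generalize m.Vmu X μ₁ u l = v at hv
  rw [← mul_one (cylBlock hl _), ← sum_cyl_single hl]
  simp only [Finset.mul_sum, Finset.sum_mul, map_sum, Complex.re_sum]
  refine Finset.sum_congr rfl fun s _ => ?_
  rw [cylBlock_mul_cyl_single, ← Complex.re_ofReal_mul,
    trace_infoDensity_mul hl ρ hv s (exp_constErr_mem X _ _)]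
  congr 2
  rw [← mul_assoc, mul_assoc _ _ v, ← (hv _).eq, mul_assoc _ v]

/-- The change of state: X = I shows that Tr ϱ_s is the density of the law of the observations with
respect to the reference weights. -/
lemma stateLin_conj (m : Model κ N) (hl : l ≤ N) (ρ : SysOp κ)
    (s : Fin l → Fin 2) {X : SysOp κ} (hX : X ∈ paramSysAlg κ) :
    stateLin ρ (star (m.U l) * (embSys X * cyl hl (Pi.single s 1)) * m.U l)
      = cylWeight hl s * (infoDensity hl ρ (m.V l) s * X).trace := by
  have hv := fun c => V_commute_cyl m hl c
  rw [trace_infoDensity_mul hl ρ hv s hX]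
  refine (stateOf_conj_congr ρ (m.U_mul_vac hl) _).trans ?_
  rw [← mul_assoc, mul_assoc _ _ (m.V l), ← (hv _).eq, ← mul_assoc]
  rfl

/-- The Bayes formula with the denominator cleared. Where Tr ϱ_s = 0 the event has probability zero
and the value of a version is arbitrary. -/
lemma IsUnitary.isCondExp_errorOp_iff (hm : m.IsUnitary) (hl : l ≤ N) (ρ : SysOp κ)
    (X : Matrix (Fin 2) (Fin 2) ℂ) (u : ∀ i, m.obsAlg i) {c : (Fin l → Fin 2) → ℂ}
    (hc : hm.obs hl c = u l) {e : (Fin l → Fin 2) → ℂ} {E : m.obsAlg l} (hE : hm.obs hl e = E) :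
    IsCondExp (stateOf ρ) (m.obsAlg l) (m.errorOp X u l) E ↔
      ∀ s, e s * (infoDensity hl ρ (m.V l) s).trace
        = (infoDensity hl ρ (m.V l) s * constErr X (c s)).trace := by
  have h1 := isCondExp_iff (stateLin ρ) (hm.obs hl) (fun A => hm.mem_obsAlg hl A)
    (m.errorOp X u l) e E hE
  have h2 : IsCondExp (stateOf ρ) (m.obsAlg l) (m.errorOp X u l) E ↔
      IsCondExp (stateLin ρ) (m.obsAlg l) (m.errorOp X u l) E := Iff.rfl
  have h3 : m.errorOp X u l = star (m.U l) * cylBlock hl (fun s => constErr X (c s)) * m.U l := by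
    rw [hm.errorOp_eq X u hl, hm.check_eq hl hc, absSq_sub_cyl]
  have hconj : ∀ A B : TotOp κ N, (star (m.U l) * A * m.U l) * (star (m.U l) * B * m.U l)
      = star (m.U l) * (A * B) * m.U l := fun A B => by
    have : (star (m.U l) * A * m.U l) * (star (m.U l) * B * m.U l)
      = star (m.U l) * A * (m.U l * star (m.U l)) * B * m.U l := by simp only [mul_assoc]
    rw [this, hm.U_mul_star_U hl, mul_one, mul_assoc (star (m.U l))]
  have hcomm : ∀ d, Commute (m.errorOp X u l) (hm.obs hl d) := fun d => by
    rw [Commute, SemiconjBy, h3, hm.obs_apply, hconj, hconj, (cylBlock_commute_cyl hl _ d).eq]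
  rw [h2, h1, and_iff_right hcomm]
  refine forall_congr' fun s => ?_
  have h0 : (cylWeight hl s : ℂ) ≠ 0 := by exact_mod_cast (cylWeight_pos hl s).ne'
  have h4 := m.stateLin_conj hl ρ s one_mem_paramSysAlg
  rw [embSys_one, one_mul, mul_one] at h4
  rw [h3, hm.obs_apply, hconj, cylBlock_mul_cyl_single, m.stateLin_conj hl ρ s (constErr_mem X _),
    h4, mul_left_comm]
  exact mul_right_inj' h0

end Model

end Filters

end RiskSensitive

end

noncomputable section

set_option linter.unusedSectionVars false

namespace RiskSensitive

/-! ### Positivity and coercivity of the exponential cost. -/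

section Minimization

open scoped ComplexOrder
open Filter Topology

variable {n : Type*} [Fintype n] [DecidableEq n]

lemma absSq_isHermitian (B : Matrix n n ℂ) : (absSq B).IsHermitian :=
  Matrix.isHermitian_conjTranspose_mul_self B

lemma smul_absSq_isHermitian (r : ℝ) (B : Matrix n n ℂ) : ((r : ℂ) • absSq B).IsHermitian := by
  rw [Matrix.IsHermitian, Matrix.conjTranspose_smul, (absSq_isHermitian B).eq]
  simp

lemma trace_mul_absSq_nonneg {D : Matrix n n ℂ} (hD : D.PosSemidef) (B : Matrix n n ℂ) :
    0 ≤ (D * absSq B).trace := by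
  have h : (D * absSq B).trace = (B * D * B.conjTranspose).trace := by
    rw [absSq, Matrix.star_eq_conjTranspose, ← mul_assoc, Matrix.trace_mul_comm, ← mul_assoc]
  rw [h]
  exact (hD.mul_mul_conjTranspose_same B).trace_nonneg

/-- `Tr[D (1 + H)] ≤ Tr[D e^H]`. -/
lemma trace_add_le_trace_mul_exp {D H : Matrix n n ℂ} (hD : D.PosSemidef) (hH : H.IsHermitian) :
    D.trace.re + (D * H).trace.re ≤ (D * NormedSpace.exp H).trace.re := by
  obtain ⟨W, g, hW, hW', hHW, -, -⟩ := exists_eq_udiag hH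
  have key : ∀ d : n → ℝ, (D * udiag W d).trace.re
      = ∑ k, d k * ((star W * D * W) k k).re := fun d => by
    rw [Matrix.trace_mul_comm, trace_udiag_mul, Complex.re_sum]
    exact Finset.sum_congr rfl fun k _ => by rw [Complex.re_ofReal_mul]
  have hone : udiag W (fun _ => 1) = 1 := by simp [udiag, hW']
  have h1 : D.trace.re = (D * udiag W (fun _ => 1)).trace.re := by rw [hone, mul_one]
  rw [hHW, exp_udiag hW, h1, key, key, key, ← Finset.sum_add_distrib]
  -- The diagonal of D in the eigenbasis of H is nonnegative, so 1 + x ≤ e^x can be summed against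
  -- it.
  refine Finset.sum_le_sum fun k _ => ?_
  rw [← add_mul]
  refine mul_le_mul_of_nonneg_right ?_
    (Complex.le_def.1 (hD.conjTranspose_mul_mul_same W).diag_nonneg).1
  linarith [Real.add_one_le_exp (g k)]

lemma trace_re_pos {D : Matrix n n ℂ} (hD : D.PosSemidef) (h : D.trace ≠ 0) :
    0 < D.trace.re ∧ (D.trace.re : ℂ) = D.trace := by
  have h1 := Complex.le_def.1 hD.trace_nonneg
  have h2 : (D.trace.re : ℂ) = D.trace := Complex.ext rfl h1.2
  refine ⟨lt_of_le_of_ne h1.1 fun h3 => h ?_, h2⟩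
  rw [← h2, ← h3]
  rfl

lemma trace_mul_exp_pos {D : Matrix n n ℂ} (hD : D.PosSemidef) (h : D.trace ≠ 0) {r : ℝ}
    (hr : 0 ≤ r) (B : Matrix n n ℂ) :
    0 < (D * NormedSpace.exp ((r : ℂ) • absSq B)).trace.re := by
  refine lt_of_lt_of_le ?_ (trace_add_le_trace_mul_exp hD (smul_absSq_isHermitian r B))
  rw [mul_smul_comm, Matrix.trace_smul, smul_eq_mul, Complex.re_ofReal_mul]
  exact add_pos_of_pos_of_nonneg (trace_re_pos hD h).1
    (mul_nonneg hr (Complex.le_def.1 (trace_mul_absSq_nonneg hD B)).1)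

lemma normalized_isDensity {D : Matrix n n ℂ} (hD : D.PosSemidef) (h : D.trace ≠ 0) :
    IsDensity (normalized D) := by
  obtain ⟨h1, h2⟩ := trace_re_pos hD h
  refine ⟨?_, ?_⟩
  · have h3 : normalized D = (D.trace.re)⁻¹ • D := by
      rw [normalized, ← h2]
      ext i j
      simp
    rw [h3]
    exact hD.smul (inv_nonneg.2 h1.le)
  · rw [normalized, Matrix.trace_smul, smul_eq_mul, inv_mul_cancel₀ h]

/-- The exponential of the squared error has an optimal constant estimate. -/
lemma exists_forall_trace_mul_exp_le {D : Matrix n n ℂ} (hD : D.PosSemidef) (A : Matrix n n ℂ)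
    {r : ℝ} (hr : 0 < r) :
    ∃ z₀ : ℂ, ∀ z : ℂ,
      (D * NormedSpace.exp ((r : ℂ) • absSq (A - z₀ • (1 : Matrix n n ℂ)))).trace.re
        ≤ (D * NormedSpace.exp ((r : ℂ) • absSq (A - z • (1 : Matrix n n ℂ)))).trace.re := by
  by_cases hD0 : D.trace = 0
  · rw [hD.trace_eq_zero_iff] at hD0
    simp [hD0]
  obtain ⟨ht, -⟩ := trace_re_pos hD hD0
  have hcont : Continuous fun z : ℂ =>
      (D * NormedSpace.exp ((r : ℂ) • absSq (A - z • (1 : Matrix n n ℂ)))).trace.re := by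
    have hexp : Continuous (NormedSpace.exp : Matrix n n ℂ → Matrix n n ℂ) := by
      let _ : NormedRing (Matrix n n ℂ) := Matrix.linftyOpNormedRing
      let _ : NormedAlgebra ℂ (Matrix n n ℂ) := Matrix.linftyOpNormedAlgebra
      let _ : NormedAlgebra ℚ (Matrix n n ℂ) := NormedAlgebra.restrictScalars ℚ ℂ _
      exact NormedSpace.exp_continuous
    have h1 : Continuous fun z : ℂ => (r : ℂ) • absSq (A - z • (1 : Matrix n n ℂ)) := by
      unfold absSq
      fun_prop
    exact Complex.continuous_re.comp
      (Continuous.matrix_trace (continuous_const.matrix_mul (hexp.comp h1)))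
  refine hcont.exists_forall_le ?_
  set t := D.trace.re with ht'
  set a : ℝ := ‖(D * A).trace‖ + ‖(D * star A).trace‖ with ha
  -- By 1 + H ≤ e^H it suffices to bound Tr[D|A - z|²], a quadratic in z with leading coefficient t
  -- = Tr D > 0. Coercivity and continuity on ℂ give a minimum.
  have hbound : ∀ z : ℂ, ‖z‖ * (r * t * ‖z‖ + -(r * a)) + t
      ≤ (D * NormedSpace.exp ((r : ℂ) • absSq (A - z • (1 : Matrix n n ℂ)))).trace.re := by
    intro z
    refine le_trans ?_ (trace_add_le_trace_mul_exp hD (smul_absSq_isHermitian r _))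
    rw [mul_smul_comm, Matrix.trace_smul, smul_eq_mul, Complex.re_ofReal_mul]
    have h1 : (D * absSq (A - z • (1 : Matrix n n ℂ))).trace
        = (D * absSq A).trace - z * (D * star A).trace - star z * (D * A).trace
          + star z * z * D.trace := by
      simp only [absSq, star_sub, star_smul, star_one, sub_mul, mul_sub, smul_mul_assoc, one_mul,
        mul_smul_comm, mul_one, Matrix.trace_sub, Matrix.trace_smul, smul_eq_mul]
      ring
    have h2 : (star z * z * D.trace).re = ‖z‖ ^ 2 * t := by
      rw [Complex.star_def, ← Complex.normSq_eq_conj_mul_self, Complex.re_ofReal_mul,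
        Complex.normSq_eq_norm_sq]
    have h3 : (z * (D * star A).trace).re ≤ ‖z‖ * ‖(D * star A).trace‖ := by
      rw [← norm_mul]
      exact Complex.re_le_norm _
    have h4 : (star z * (D * A).trace).re ≤ ‖z‖ * ‖(D * A).trace‖ := by
      refine (Complex.re_le_norm _).trans ?_
      rw [norm_mul, norm_star]
    have h5 := (Complex.le_def.1 (trace_mul_absSq_nonneg hD A)).1
    rw [Complex.zero_re] at h5
    rw [h1, Complex.add_re, Complex.sub_re, Complex.sub_re, h2]
    have h6 : ‖z‖ * (t * ‖z‖) - ‖z‖ * a ≤ (D * absSq A).trace.re - (z * (D * star A).trace).re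
        - (star z * (D * A).trace).re + ‖z‖ ^ 2 * t := by
      rw [ha]
      nlinarith
    have h7 := mul_le_mul_of_nonneg_left h6 hr.le
    linarith
  refine tendsto_atTop_mono hbound (tendsto_atTop_add_const_right _ _ ?_)
  have h8 : Tendsto (fun x : ℝ => x * (r * t * x + -(r * a))) atTop atTop :=
    tendsto_id.atTop_mul_atTop₀ (tendsto_atTop_add_const_right _ _
      (tendsto_id.const_mul_atTop (mul_pos hr ht)))
  exact h8.comp tendsto_norm_cocompact_atTop

end Minimization

/-! ### Existence of versions and estimators, and the pointwise bounds. -/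

section Main

open scoped ComplexOrder

variable {κ : Type*} [Fintype κ] [DecidableEq κ]

lemma logTerm_normalized {D : SysOp κ} (hD : D.PosSemidef) (h : D.trace ≠ 0)
    (X : Matrix (Fin 2) (Fin 2) ℂ) (μ : ℝ) (z : ℂ) :
    logTerm (normalized D) X μ z = 1 / μ * Real.log (D.trace.re⁻¹ *
      (D * NormedSpace.exp ((μ : ℂ) • constErr X z)).trace.re) := by
  rw [logTerm, normalized, smul_mul_assoc, Matrix.trace_smul, smul_eq_mul,
    ← (trace_re_pos hD h).2, ← Complex.ofReal_inv, Complex.re_ofReal_mul, Complex.ofReal_re]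
  rfl

namespace Model

variable {N : ℕ} {m : Model κ N} {l : ℕ}

lemma IsUnitary.exists_isCondExp (hm : m.IsUnitary) (hl : l ≤ N) {ρ : SysOp κ}
    (hρ : ρ.PosSemidef) (X : Matrix (Fin 2) (Fin 2) ℂ) (u : ∀ i, m.obsAlg i) :
    ∃ E, IsCondExp (stateOf ρ) (m.obsAlg l) (m.errorOp X u l) E := by
  obtain ⟨c, hc⟩ := (hm.mem_obsAlg hl _).1 (u l).2
  let e : (Fin l → Fin 2) → ℂ := fun s => (infoDensity hl ρ (m.V l) s * constErr X (c s)).trace /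
    (infoDensity hl ρ (m.V l) s).trace
  refine ⟨⟨hm.obs hl e, (hm.mem_obsAlg hl _).2 ⟨e, rfl⟩⟩,
    (hm.isCondExp_errorOp_iff hl ρ X u hc rfl).2 fun s => ?_⟩
  -- A positive matrix of trace zero vanishes, so both sides are zero in the degenerate case.
  by_cases h : (infoDensity hl ρ (m.V l) s).trace = 0
  · have h1 := (infoDensity_posSemidef hl hρ (m.V l) s).trace_eq_zero_iff.1 h
    simp [h1]
  · exact div_mul_cancel₀ _ h

lemma IsUnitary.exists_isSuboptimal (hm : m.IsUnitary) {ρ : SysOp κ} (hρ : ρ.PosSemidef)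
    (X : Matrix (Fin 2) (Fin 2) ℂ) (μ₁ : ℝ) {μ₂ : ℝ} (hμ₂ : 0 < μ₂) :
    ∃ v, m.IsSuboptimal ρ X μ₁ μ₂ v := by
  have key : ∀ k : ℕ, ∃ v : ∀ i, m.obsAlg i, ∀ l, 1 ≤ l → l ≤ k → l ≤ N → ∀ w : m.obsAlg l,
      m.cost ρ X μ₁ μ₂ v l ≤ m.cost ρ X μ₁ μ₂ (Function.update v l w) l := by
    intro k
    induction k with
    | zero => exact ⟨0, fun l h1 h2 => by omega⟩
    | succ k ih =>
      obtain ⟨v, hv⟩ := ih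
      by_cases hk : k + 1 ≤ N
      swap
      · exact ⟨v, fun l h1 h2 h3 => hv l h1 (by omega) h3⟩
      -- Any function of the configuration is an element of the observation algebra, so the
      -- pointwise minimizers form an admissible estimate.
      choose z hz using fun s => exists_forall_trace_mul_exp_le
        (infoDensity_posSemidef hk hρ (m.Vmu X μ₁ v (k + 1)) s) (atomOp X) hμ₂
      let b : m.obsAlg (k + 1) := ⟨hm.obs hk z, (hm.mem_obsAlg hk _).2 ⟨z, rfl⟩⟩
      refine ⟨Function.update v (k + 1) b, fun l h1 h2 h3 w => ?_⟩
      rcases Nat.lt_or_ge l (k + 1) with h4 | h4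
      · have h5 : m.cost ρ X μ₁ μ₂ (Function.update v (k + 1) b) l = m.cost ρ X μ₁ μ₂ v l :=
          cost_congr fun i hi => Function.update_of_ne (by omega) _ _
        have h6 : m.cost ρ X μ₁ μ₂ (Function.update (Function.update v (k + 1) b) l w) l
            = m.cost ρ X μ₁ μ₂ (Function.update v l w) l := cost_congr fun i hi => by
          rw [Function.update_comm (by omega), Function.update_of_ne (by omega)]
        rw [h5, h6]
        exact hv l h1 (by omega) h3 w
      · obtain rfl : l = k + 1 := by omega
        obtain ⟨d, hd⟩ := (hm.mem_obsAlg hk _).1 w.2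
        rw [Function.update_idem]
        have h5 : ∀ w', m.Vmu X μ₁ (Function.update v (k + 1) w') (k + 1)
            = m.Vmu X μ₁ v (k + 1) := fun w' =>
          Vmu_congr fun i hi => Function.update_of_ne (by omega) _ _
        rw [hm.cost_eq hk ρ X μ₁ μ₂ (Function.update v (k + 1) b) (c := z)
            (by rw [Function.update_self]),
          hm.cost_eq hk ρ X μ₁ μ₂ (Function.update v (k + 1) w) (c := d)
            (by rw [Function.update_self, hd]), h5, h5]
        exact Finset.sum_le_sum fun s _ =>
          mul_le_mul_of_nonneg_left (hz s (d s)) (cylWeight_pos hk s).le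
  obtain ⟨v, hv⟩ := key N
  exact ⟨v, fun l h1 h2 w => hv l h1 h2 h2 w⟩

/-- A suboptimal estimator minimizes the conditional cost on every event. -/
lemma IsUnitary.trace_mul_exp_le_of_isSuboptimal (hm : m.IsUnitary) (h1 : 1 ≤ l) (hl : l ≤ N)
    {ρ : SysOp κ} {X : Matrix (Fin 2) (Fin 2) ℂ} {μ₁ μ₂ : ℝ} {u : ∀ i, m.obsAlg i}
    (hu : m.IsSuboptimal ρ X μ₁ μ₂ u) {c : (Fin l → Fin 2) → ℂ} (hc : hm.obs hl c = u l)
    (s : Fin l → Fin 2) (z : ℂ) :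
    (infoDensity hl ρ (m.Vmu X μ₁ u l) s *
        NormedSpace.exp ((μ₂ : ℂ) • constErr X (c s))).trace.re
      ≤ (infoDensity hl ρ (m.Vmu X μ₁ u l) s *
        NormedSpace.exp ((μ₂ : ℂ) • constErr X z)).trace.re := by
  -- The competitor differs from the estimate on one configuration only, so all other summands of
  -- the cost cancel.
  let d : (Fin l → Fin 2) → ℂ := Function.update c s z
  let w : m.obsAlg l := ⟨hm.obs hl d, (hm.mem_obsAlg hl _).2 ⟨d, rfl⟩⟩
  have h2 := hu l h1 hl w
  rw [hm.cost_eq hl ρ X μ₁ μ₂ u hc,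
    hm.cost_eq hl ρ X μ₁ μ₂ (Function.update u l w) (c := d) (by rw [Function.update_self]),
    Vmu_congr (u := Function.update u l w) (u' := u)
      fun i hi => Function.update_of_ne (by omega) _ _,
    ← Finset.add_sum_erase _ _ (Finset.mem_univ s), ← Finset.add_sum_erase _ _ (Finset.mem_univ s),
    Finset.sum_congr rfl fun s' hs' => by
      rw [show c s' = d s' from (Function.update_of_ne (Finset.ne_of_mem_erase hs') _ _).symm],
    add_le_add_iff_right, show d s = z from Function.update_self _ _ _] at h2
  exact le_of_mul_le_mul_left h2 (cylWeight_pos hl s)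

/-- The trace of the true filter does not vanish almost surely. -/
lemma IsUnitary.ae_trace_ne_zero (hm : m.IsUnitary) (hl : l ≤ N) {Ω : Type*} [MeasurableSpace Ω]
    (ι : SpectralIso (m.obsAlg l) Ω) {ρ : SysOp κ} {pt : Ω → Fin l → Fin 2}
    (hpt : ∀ (ω : Ω) (A : m.obsAlg l) (c : (Fin l → Fin 2) → ℂ),
      hm.obs hl c = A → ι.toHom A ω = c (pt ω)) (Q : MeasureTheory.Measure Ω)
    [MeasureTheory.IsProbabilityMeasure Q] (hQ : ι.Represents (stateOf ρ) Q) :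
    ∀ᵐ ω ∂Q, (infoDensity hl ρ (m.V l) (pt ω)).trace ≠ 0 := by
  have key : ∀ s, (infoDensity hl ρ (m.V l) s).trace = 0 → ∀ᵐ ω ∂Q, pt ω ≠ s := by
    intro s hs
    let q : m.obsAlg l := ⟨hm.obs hl (Pi.single s 1), (hm.mem_obsAlg hl _).2 ⟨_, rfl⟩⟩
    have h1 : ∀ ω, ι.toHom q ω = (Pi.single s 1 : (Fin l → Fin 2) → ℂ) (pt ω) :=
      fun ω => hpt ω q _ rfl
    have h2 : Measurable (ι.toHom q) := by
      have h3 : ι.toHom q ∈ Set.range ι.toHom := ⟨q, rfl⟩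
      rw [ι.range_eq] at h3
      exact h3.1
    -- Measurability of the event comes from the range condition on ι; `pt` itself is merely a
    -- function.
    have h3 : {ω | pt ω = s} = ι.toHom q ⁻¹' {1} := by
      ext ω
      rw [Set.mem_preimage, h1]
      by_cases h : pt ω = s
      · simp [h]
      · simp [h]
    have h4 : MeasurableSet {ω | pt ω = s} := h3 ▸ h2 (measurableSet_singleton 1)
    have h5 : ι.toHom q = {ω | pt ω = s}.indicator fun _ => (1 : ℂ) := by
      ext1 ω
      rw [h1]
      by_cases h : pt ω = s
      · simp [h]
      · simp [h]
    have h6 := hQ q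
    rw [h5, MeasureTheory.integral_indicator_const _ h4] at h6
    have h7 := m.stateLin_conj hl ρ s one_mem_paramSysAlg
    rw [embSys_one, one_mul, mul_one, hs, mul_zero, ← hm.obs_apply] at h7
    have h8 : stateOf ρ (q : TotOp κ N) = 0 := h7
    rw [h8] at h6
    have h9 : Q.real {ω | pt ω = s} = 0 := by
      simpa using h6.symm
    rw [MeasureTheory.measureReal_eq_zero_iff] at h9
    exact MeasureTheory.measure_eq_zero_iff_ae_notMem.1 h9
  have h : ∀ᵐ ω ∂Q, ∀ s, (infoDensity hl ρ (m.V l) s).trace = 0 → pt ω ≠ s := by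
    rw [MeasureTheory.ae_all_iff]
    intro s
    by_cases hs : (infoDensity hl ρ (m.V l) s).trace = 0
    · exact (key s hs).mono fun ω hω _ => hω
    · exact Filter.Eventually.of_forall fun ω h => absurd h hs
  exact h.mono fun ω hω h0 => hω _ h0 rfl

end Model

/-- The bound of the conditional error by the risk-sensitive cost and the relative entropy. -/
lemma error_le_logTerm_add_relEntropy {D D' : SysOp κ} (hD : D.PosSemidef) (hD' : D'.PosSemidef)
    (h : D.trace ≠ 0) (h' : D'.trace ≠ 0) (X : Matrix (Fin 2) (Fin 2) ℂ) {μ : ℝ} (hμ : 0 < μ)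
    (z : ℂ) {e : ℂ} (he : e * D.trace = (D * constErr X z).trace) :
    e.im = 0 ∧ ((e.re : ℝ) : EReal) ≤ ((logTerm (normalized D') X μ z : ℝ) : EReal)
      + ((1 / μ : ℝ) : EReal) * relEntropy (normalized D) (normalized D') := by
  have hn := normalized_isDensity hD h
  have hn' := normalized_isDensity hD' h'
  have he' : e = (normalized D * constErr X z).trace := by
    rw [normalized, smul_mul_assoc, Matrix.trace_smul, ← he, smul_eq_mul]
    field_simp
  refine ⟨?_, ?_⟩
  · rw [he']
    exact (Complex.le_def.1 (trace_mul_absSq_nonneg hn.1 _)).2.symm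
  -- The duality with G = μ|X - z|², whose mean under the true filter is μ e.
  have h1 := trace_mul_le_log_add_relEntropy hn hn' (smul_absSq_isHermitian μ
    (atomOp X - z • (1 : SysOp κ)))
  change ((normalized D * ((μ : ℂ) • constErr X z)).trace.re : EReal) ≤ _ at h1
  rw [mul_smul_comm, Matrix.trace_smul, ← he', smul_eq_mul, Complex.re_ofReal_mul] at h1
  rw [logTerm]
  generalize Real.log _ = L at h1 ⊢
  have hμ' : (0 : ℝ) < 1 / μ := one_div_pos.2 hμ
  rw [relEntropy] at h1 ⊢
  split_ifs at h1 ⊢ with hs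
  · rw [← EReal.coe_add, EReal.coe_le_coe_iff] at h1
    rw [← EReal.coe_mul, ← EReal.coe_add, EReal.coe_le_coe_iff, ← mul_add, one_div,
      ← div_eq_inv_mul, le_div_iff₀ hμ, mul_comm]
    exact h1
  · rw [EReal.mul_top_of_pos (by exact_mod_cast hμ'), EReal.coe_add_top]
    exact le_top

end Main

end RiskSensitive

end

theorem theorem6p2 {κ : Type*} [Fintype κ] [DecidableEq κ] {N : ℕ}
    -- the interaction, the operator to be estimated, the risk parameters
    (m : Model κ N) (hm : m.IsUnitary)
    (Xe : Matrix (Fin 2) (Fin 2) ℂ) (μ₁ μ₂ : ℝ) (hμ₂ : 0 < μ₂)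
    -- the true and the nominal density matrices
    (rtrue rnom : κ → ℝ) (hrtrue : rtrue ∈ stdSimplex ℝ κ) (hrnom : rnom ∈ stdSimplex ℝ κ)
    (ρtrue ρnom : Matrix (Fin 2) (Fin 2) ℂ) (hρtrue : IsDensity ρtrue) (hρnom : IsDensity ρnom)
    -- the estimators, a time, and a classical realization of the observations up to that time
    (u : ∀ i, m.obsAlg i) (l : ℕ) (hl : 1 ≤ l) (hlN : l ≤ N)
    {Ω : Type*} [MeasurableSpace Ω] (ι : SpectralIso (m.obsAlg l) Ω) :
    -- the conditional expectation, the two filters and the suboptimal estimator exist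
    (∃ E, IsCondExp (stateOf (prodDensity rtrue ρtrue)) (m.obsAlg l) (m.errorOp Xe u l) E) ∧
    (∃! ϱ, m.IsInfoDensity (prodDensity rtrue ρtrue) (m.V l) l ι ϱ) ∧
    (∃! ϱ, m.IsInfoDensity (prodDensity rnom ρnom) (m.Vmu Xe μ₁ u l) l ι ϱ) ∧
    (∃ v, m.IsSuboptimal (prodDensity rnom ρnom) Xe μ₁ μ₂ v) ∧
    ∀ ϱtrue ϱnom : Ω → SysOp κ,
      m.IsInfoDensity (prodDensity rtrue ρtrue) (m.V l) l ι ϱtrue →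
      m.IsInfoDensity (prodDensity rnom ρnom) (m.Vmu Xe μ₁ u l) l ι ϱnom →
      -- the normalized true filter is defined almost surely under the true state
      (∀ Q : MeasureTheory.Measure Ω, MeasureTheory.IsProbabilityMeasure Q →
        ι.Represents (stateOf (prodDensity rtrue ρtrue)) Q → ∀ᵐ ω ∂Q, (ϱtrue ω).trace ≠ 0) ∧
      -- the bound for the conditional estimation error
      (∀ E, IsCondExp (stateOf (prodDensity rtrue ρtrue)) (m.obsAlg l) (m.errorOp Xe u l) E →
        ∀ ω, (ϱtrue ω).trace ≠ 0 → (ϱnom ω).trace ≠ 0 →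
          (ι.toHom E ω).im = 0 ∧
          (((ι.toHom E ω).re : ℝ) : EReal) ≤
            ((logTerm (normalized (ϱnom ω)) Xe μ₂ (ι.toHom (u l) ω) : ℝ) : EReal)
              + ((1 / μ₂ : ℝ) : EReal)
                * relEntropy (normalized (ϱtrue ω)) (normalized (ϱnom ω))) ∧
      -- the suboptimal estimator minimizes the first term
      (m.IsSuboptimal (prodDensity rnom ρnom) Xe μ₁ μ₂ u →
        ∀ ω, (ϱnom ω).trace ≠ 0 → ∀ z : ℂ,
          logTerm (normalized (ϱnom ω)) Xe μ₂ (ι.toHom (u l) ω)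
            ≤ logTerm (normalized (ϱnom ω)) Xe μ₂ z) := by
  obtain ⟨hT, hT1⟩ := prodDensity_isDensity hrtrue hρtrue
  obtain ⟨hM, hM1⟩ := prodDensity_isDensity hrnom hρnom
  obtain ⟨pt, hpt⟩ := hm.exists_point hlN ι
  obtain ⟨c, hc⟩ := (hm.mem_obsAlg hlN _).1 (u l).2
  have hItrue := hm.isInfoDensity_iff hlN ι hT1 (m.V_commute_cyl hlN) hpt
  have hInom := hm.isInfoDensity_iff hlN ι hM1 (hm.Vmu_commute_cyl Xe μ₁ u hlN) hpt
  refine ⟨hm.exists_isCondExp hlN hT Xe u, ⟨_, (hItrue _).2 rfl, fun ϱ h => (hItrue ϱ).1 h⟩,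
    ⟨_, (hInom _).2 rfl, fun ϱ h => (hInom ϱ).1 h⟩, hm.exists_isSuboptimal hM Xe μ₁ hμ₂, ?_⟩
  intro ϱtrue ϱnom htrue hnom
  -- By uniqueness the given filters are the explicit ones, and the remaining claims concern one
  -- configuration at a time.
  obtain rfl := (hItrue _).1 htrue
  obtain rfl := (hInom _).1 hnom
  refine ⟨fun Q _ hQ => hm.ae_trace_ne_zero hlN ι hpt Q hQ, fun E hE ω h1 h2 => ?_,
    fun hu ω h1 z => ?_⟩
  · obtain ⟨e, he⟩ := (hm.mem_obsAlg hlN _).1 E.2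
    rw [hpt ω E e he, hpt ω (u l) c hc]
    exact error_le_logTerm_add_relEntropy (infoDensity_posSemidef hlN hT _ _)
      (infoDensity_posSemidef hlN hM _ _) h1 h2 Xe hμ₂ _
      ((hm.isCondExp_errorOp_iff hlN _ Xe u hc he).1 hE _)
  · have hD := infoDensity_posSemidef hlN hM (m.Vmu Xe μ₁ u l) (pt ω)
    have ht := (trace_re_pos hD h1).1
    rw [hpt ω (u l) c hc, logTerm_normalized hD h1, logTerm_normalized hD h1]
    refine mul_le_mul_of_nonneg_left (Real.log_le_log ?_ ?_) (one_div_pos.2 hμ₂).le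
    · exact mul_pos (inv_pos.2 ht) (trace_mul_exp_pos hD h1 hμ₂.le _)
    · exact mul_le_mul_of_nonneg_left (hm.trace_mul_exp_le_of_isSuboptimal hl hlN hu hc _ z)
        (inv_pos.2 ht).le
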